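/- Let $m\ge 1$ be an integer. Let $G_3$ and $G_2$ be the distribution functions of the Beta law $\beta_{m,m}$ and of the Gamma law $\Gamma(2m,1)$, let $Q_i(v)=\inf\{x\ge 0: G_i(x)\ge v\}$ for $0<v<1$ be their quantile functions and $q_i=Q_i'$ on $(0,1)$ their quantile densities ($i=2,3$). Let $\{\mathbf B(v,w):0\le v,w\le 1\}$ be a bivariate Brownian bridge, i.e. a centred Gaussian process with (almost surely) continuous sample paths and $$\mathbb E\big(\mathbf B(v,w)\mathbf B(v',w')\big)=(v\wedge v')(w\wedge w')-vv'ww'.$$ For $0\le v,w\le 1$ put $$\mathbf B^*(1-v,1-w)=\mathbf B(v,w)-\mathbf B(v,1)-\mathbf B(1,w),$$ $$\mathbf B^*_{[0]}(v,w)=\mathbf B^*(v,w)-v\,\mathbf B^*(1,w)-w\,\mathbf B^*(v,1),\qquad B^*_{[1]}(v)=\mathbf B^*(v,1),\qquad B^*_{[2]}(w)=\mathbf B^*(1,w).$$ For $f\in L^2([0,1]^2)$ let $\iint f\,\mathbf B(dv,dw)$ denote the Wiener integral, i.e. the $L^2(\mathbb P)$-limit of the elementary integrals of step functions converging to $f$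 in $L^2([0,1]^2)$, where the elementary integral of the indicator of $(a,b]\times(c,d]$ is $\mathbf B(b,d)-\mathbf B(a,d)-\mathbf B(b,c)+\mathbf B(a,c)$. Define $$X_0=2\iint_{[0,1]^2}q_3(1-v)\,q_2(1-w)\,\mathbf B^*_{[0]}(v,w)\,dv\,dw,\qquad X_1=4m\int_0^1 q_3(1-v)\,B^*_{[1]}(v)\,dv,\qquad X_2=\int_0^1 q_2(1-w)\,B^*_{[2]}(w)\,dw.$$ Then both Wiener integrals below exist, all the pathwise integrals in this statement converge absolutely almost surely, and, almost surely, $$\iint_{[0,1]^2}(2Q_3(v)-1)\,Q_2(w)\,\mathbf B(dv,dw)=2\iint_{[0,1]^2}q_3(1-v)q_2(1-w)\mathbf B^*(v,w)\,dv\,dw-\int_0^1 q_2(1-w)\mathbf B^*(1,w)\,dw$$ $$=X_0+X_1=2\iint_{[0,1]\times[0,\infty)}\mathbf B^*_{[0]}\big(1-G_3(x),1-G_2(y)\big)\,dx\,dy+4m\int_0^1B^*_{[1]}\big(1-G_3(x)\big)\,dx,$$ this random variable having the law $N(0,2m)$, and $$\iint_{[0,1]^2}Q_2(w)\,\mathbf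 B(dv,dw)=-\int_0^1q_2(w)\,\mathbf B(1,w)\,dw=\int_0^1q_2(1-w)\,\mathbf B^*(1,w)\,dw=X_2 .$$ Moreover, almost surely, $$X_0=2\iint_{[0,1]\times[0,\infty)}\mathbf B^*_{[0]}\big(1-G_3(x),1-G_2(y)\big)\,dx\,dy,\qquad X_1=4m\int_0^1B^*_{[1]}\big(1-G_3(x)\big)\,dx=-4m\int_0^1\mathbf B(G_3(x),1)\,dx,$$ the random variables $X_0,X_1,X_2$ are (mutually) independent, and $$X_0\sim N\Big(0,\frac{2m}{2m+1}\Big),\qquad X_1\sim N\Big(0,\frac{4m^2}{2m+1}\Big),\qquad X_2\sim N(0,2m).$$ -/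

import Mathlib

open MeasureTheory ProbabilityTheory Filter Topology
open scoped NNReal ENNReal

noncomputable section

namespace Bridge

/-- A bivariate Brownian bridge `{B(u,v) : 0 ≤ u, v ≤ 1}`: a centred Gaussian process indexed by the
unit square, with (almost surely) continuous sample paths there, and covariance
`E (B(u,v) B(u',v')) = (u ∧ u') (v ∧ v') - u u' v v'`. The values of `B` off the unit square are
irrelevant. -/
structure IsBivariateBrownianBridge {Ω : Type*} [MeasurableSpace Ω]
    (B : ℝ → ℝ → Ω → ℝ) (P : Measure Ω) : Prop where
  gaussian : IsGaussianProcess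
    (fun (p : Set.Icc (0 : ℝ) 1 × Set.Icc (0 : ℝ) 1) (ω : Ω) => B p.1 p.2 ω) P
  centred : ∀ u ∈ Set.Icc (0 : ℝ) 1, ∀ v ∈ Set.Icc (0 : ℝ) 1, ∫ ω, B u v ω ∂P = 0
  covariance : ∀ u ∈ Set.Icc (0 : ℝ) 1, ∀ v ∈ Set.Icc (0 : ℝ) 1,
    ∀ u' ∈ Set.Icc (0 : ℝ) 1, ∀ v' ∈ Set.Icc (0 : ℝ) 1,
      ∫ ω, B u v ω * B u' v' ω ∂P = min u u' * min v v' - u * u' * v * v'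
  continuous_paths : ∀ᵐ ω ∂P,
    ContinuousOn (fun p : ℝ × ℝ => B p.1 p.2 ω) (Set.Icc 0 1 ×ˢ Set.Icc 0 1)

/-! ### The stochastic integral of a deterministic function against `B(dv,dw)` -/

/-- A half-open rectangle `(a, b] × (c, d]` contained in the unit square. -/
structure Rect where
  a : ℝ
  b : ℝ
  c : ℝ
  d : ℝ
  ha : 0 ≤ a
  hab : a ≤ b
  hb : b ≤ 1
  hc : 0 ≤ c
  hcd : c ≤ d
  hd : d ≤ 1

/-- The subset of the plane. -/
def Rect.toSet (R : Rect) : Set (ℝ × ℝ) := Set.Ioc R.a R.b ×ˢ Set.Ioc R.c R.d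

/-- The mass `B((a, b] × (c, d])`, i.e. the rectangular increment of `B`. -/
def Rect.mass {Ω : Type*} (R : Rect) (B : ℝ → ℝ → Ω → ℝ) (ω : Ω) : ℝ :=
  B R.b R.d ω - B R.a R.d ω - B R.b R.c ω + B R.a R.c ω

/-- A step function `∑ i, coef i * 1_{rect i}` on the unit square. -/
structure Step where
  n : ℕ
  coef : Fin n → ℝ
  rect : Fin n → Rect

/-- The values of the step function. -/
def Step.eval (s : Step) (p : ℝ × ℝ) : ℝ :=
  ∑ i, s.coef i * (s.rect i).toSet.indicator (fun _ => (1 : ℝ)) p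

/-- The elementary integral `∫∫ s(v,w) B(dv,dw) = ∑ i, coef i * B(rect i)`. -/
def Step.integral {Ω : Type*} (s : Step) (B : ℝ → ℝ → Ω → ℝ) (ω : Ω) : ℝ :=
  ∑ i, s.coef i * (s.rect i).mass B ω

/-- `HasStochIntegral P B f J` says that the square integrable random variable `J` is (a version of)
the Wiener integral `∫∫_{[0,1]²} f(v,w) B(dv,dw)` of the deterministic function `f ∈ L²([0,1]²)`: the
limit in `L²(P)` of the elementary integrals of step functions that converge to `f` in
`L²([0,1]²)`. -/
def HasStochIntegral {Ω : Type*} [MeasurableSpace Ω] (P : Measure Ω) (B : ℝ → ℝ → Ω → ℝ)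
    (f : ℝ × ℝ → ℝ) (J : Ω → ℝ) : Prop :=
  MemLp f 2 (volume.restrict (Set.Icc 0 1 ×ˢ Set.Icc 0 1)) ∧ MemLp J 2 P ∧
  ∃ s : ℕ → Step,
    Tendsto (fun n => eLpNorm (fun p => (s n).eval p - f p) 2
      (volume.restrict (Set.Icc 0 1 ×ˢ Set.Icc 0 1))) atTop (𝓝 0) ∧
    Tendsto (fun n => eLpNorm (fun ω => (s n).integral B ω - J ω) 2 P) atTop (𝓝 0)

/-! ### Distribution functions, quantile functions and quantile densities -/

/-- The distribution function of the Beta law with parameters `m` and `m`. -/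
def G₃ (m : ℕ) (x : ℝ) : ℝ := cdf (betaMeasure m m) x

/-- The distribution function of the Gamma law with shape `2m` and scale `1`. -/
def G₂ (m : ℕ) (x : ℝ) : ℝ := cdf (gammaMeasure (2 * m) 1) x

/-- The quantile function of the Beta law. -/
def Q₃ (m : ℕ) (v : ℝ) : ℝ := sInf {x : ℝ | 0 ≤ x ∧ v ≤ G₃ m x}

/-- The quantile function of the Gamma law. -/
def Q₂ (m : ℕ) (w : ℝ) : ℝ := sInf {x : ℝ | 0 ≤ x ∧ w ≤ G₂ m x}

/-- The quantile density of the Beta law. -/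
def q₃ (m : ℕ) (v : ℝ) : ℝ := deriv (Q₃ m) v

/-- The quantile density of the Gamma law. -/
def q₂ (m : ℕ) (w : ℝ) : ℝ := deriv (Q₂ m) w

/-! ### The bridge `B*` and its components -/

variable {Ω : Type*}

/-- `B*(1-v, 1-w) = B(v,w) - B(v,1) - B(1,w)`. -/
def star (B : ℝ → ℝ → Ω → ℝ) (v w : ℝ) (ω : Ω) : ℝ :=
  B (1 - v) (1 - w) ω - B (1 - v) 1 ω - B 1 (1 - w) ω

/-- The reduced bridge `B*_[0](v,w) = B*(v,w) - v B*(1,w) - w B*(v,1)`. -/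
def star₀ (B : ℝ → ℝ → Ω → ℝ) (v w : ℝ) (ω : Ω) : ℝ :=
  star B v w ω - v * star B 1 w ω - w * star B v 1 ω

/-- The first marginal bridge `B*_[1](v) = B*(v,1)`. -/
def star₁ (B : ℝ → ℝ → Ω → ℝ) (v : ℝ) (ω : Ω) : ℝ := star B v 1 ω

/-- The second marginal bridge `B*_[2](w) = B*(1,w)`. -/
def star₂ (B : ℝ → ℝ → Ω → ℝ) (w : ℝ) (ω : Ω) : ℝ := star B 1 w ω

/-- `2 ∫∫_{[0,1]²} q₃(1-v) q₂(1-w) B*_[0](v,w) dv dw`. -/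
def X₀ (m : ℕ) (B : ℝ → ℝ → Ω → ℝ) (ω : Ω) : ℝ :=
  2 * ∫ p in Set.Icc (0 : ℝ) 1 ×ˢ Set.Icc (0 : ℝ) 1,
    q₃ m (1 - p.1) * q₂ m (1 - p.2) * star₀ B p.1 p.2 ω

/-- `4m ∫_{[0,1]} q₃(1-v) B*_[1](v) dv`. -/
def X₁ (m : ℕ) (B : ℝ → ℝ → Ω → ℝ) (ω : Ω) : ℝ :=
  4 * m * ∫ v in Set.Icc (0 : ℝ) 1, q₃ m (1 - v) * star₁ B v ω

/-- `∫_{[0,1]} q₂(1-w) B*_[2](w) dw`. -/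
def X₂ (m : ℕ) (B : ℝ → ℝ → Ω → ℝ) (ω : Ω) : ℝ :=
  ∫ w in Set.Icc (0 : ℝ) 1, q₂ m (1 - w) * star₂ B w ω

end Bridge

end

/-! ### Rectangles in the unit square and their indicators -/

noncomputable section

namespace Bridge

/-! Everything reduces to three pathwise integrals of corner masses `corner B s t` = B((s,1]×(t,1]):
`stripInt` (s = G₃(x), t = G₂(y), integrated over the strip), `stripInt₁` (t = 0, integrated in x)
and `stripInt₂` (s = 0, integrated over the strip).

These are Wiener integrals. By the layer-cake formula Q₃(v) is the integral over x in [0,1] of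
1{G₃(x) < v}, and Q₂(w) that over y ≥ 0 of 1{G₂(y) < w}. A stochastic Fubini theorem
(`HasStochIntegral.average`, `hasStochIntegral_strip`) exchanges these integrals with B(dv,dw), so
the Wiener integrals of Q₃Q₂, Q₃ and Q₂ are `stripInt`, `stripInt₁` and `stripInt₂`.

They also give the pathwise expressions of the statement. Almost surely B(1,1) = 0, so B*(1-s,1-t)
is a corner mass, and the substitutions v = 1 - G₃(x), w = 1 - G₂(y) absorb the quantile densities
(`change_var`, `change_var₂`). Since the Beta and Gamma means are 1/2 and 2m, X₀ = 2 `stripInt` - 4m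
`stripInt₁` - `stripInt₂`, X₁ = 4m `stripInt₁` and X₂ = `stripInt₂`.

For the laws, the Wiener integral of f is centred Gaussian, with variance that of f under the
uniform law on the square (`HasStochIntegral.hasLaw`). Up to additive constants, which contribute no
variance, X₀, X₁, X₂ have integrands 2(Q₃-1/2)(Q₂-2m), 4m(Q₃-1/2) and Q₂-2m. As Q₃(v) and Q₂(w) are
independent under the uniform law, these are pairwise orthogonal. Every linear combination of the
X's is therefore Gaussian with the variance it would have under independence, and characteristic
functions turn this into independence (`iIndepFun_of_hasLaw_sum`). -/

/-- Lebesgue measure on the unit square. -/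
abbrev squareMeasure : Measure (ℝ × ℝ) := volume.restrict (Set.Icc 0 1 ×ˢ Set.Icc 0 1)

lemma squareMeasure_eq_prod : squareMeasure =
    (volume.restrict (Set.Icc (0 : ℝ) 1)).prod (volume.restrict (Set.Icc (0 : ℝ) 1)) := by
  rw [Measure.prod_restrict]; rfl

instance : IsProbabilityMeasure (volume.restrict (Set.Icc (0 : ℝ) 1)) :=
  ⟨by simp⟩

instance : IsProbabilityMeasure squareMeasure := by
  rw [squareMeasure_eq_prod]; infer_instance

/-- The indicator function of a rectangle. -/
def Rect.ind (R : Rect) (p : ℝ × ℝ) : ℝ := R.toSet.indicator (fun _ => (1 : ℝ)) p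

lemma Rect.ind_eq_mul (R : Rect) (p : ℝ × ℝ) :
    R.ind p = (Set.Ioc R.a R.b).indicator 1 p.1 * (Set.Ioc R.c R.d).indicator 1 p.2 := by
  classical
  simp only [Rect.ind, Rect.toSet, Set.indicator_apply, Set.mem_prod, Pi.one_apply]
  split_ifs <;> simp_all

@[fun_prop]
lemma Rect.measurable_ind (R : Rect) : Measurable R.ind :=
  measurable_const.indicator (measurableSet_Ioc.prod measurableSet_Ioc)

lemma Rect.abs_ind_le (R : Rect) (p : ℝ × ℝ) : |R.ind p| ≤ 1 := by
  classical
  simp only [Rect.ind, Set.indicator_apply]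
  split_ifs <;> simp

/-- The length of the intersection of two intervals. -/
lemma integral_indicator_Ioc_mul {a b a' b' : ℝ} (ha : 0 ≤ a) (hab : a ≤ b) (hb : b ≤ 1)
    (hab' : a' ≤ b') :
    ∫ x in Set.Icc (0 : ℝ) 1, (Set.Ioc a b).indicator (1 : ℝ → ℝ) x *
      (Set.Ioc a' b').indicator (1 : ℝ → ℝ) x =
    min b b' - min a b' - min b a' + min a a' := by
  have h : ∀ x, (Set.Ioc a b).indicator (1 : ℝ → ℝ) x * (Set.Ioc a' b').indicator (1 : ℝ → ℝ) x
      = (Set.Ioc (max a a') (min b b')).indicator (1 : ℝ → ℝ) x := by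
    intro x
    classical
    rw [← Set.Ioc_inter_Ioc, Set.inter_indicator_one]; rfl
  simp_rw [h]
  rw [integral_indicator_one measurableSet_Ioc, measureReal_restrict_apply measurableSet_Ioc,
    Set.inter_eq_left.2 (show Set.Ioc (max a a') (min b b') ⊆ Set.Icc 0 1 from fun x hx =>
      ⟨ha.trans ((le_max_left _ _).trans hx.1.le), hx.2.trans ((min_le_left _ _).trans hb)⟩),
    measureReal_def, Real.volume_Ioc,
    ENNReal.toReal_ofReal']
  -- The length is max(min b b' - max a a', 0); each ordering of the endpoints decides whether the
  -- truncation at 0 is active.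
  rcases le_total b b' with h1 | h1 <;> rcases le_total a a' with h2 | h2 <;>
  rcases le_total a b' with h3 | h3 <;> rcases le_total b a' with h4 | h4 <;>
  simp only [min_eq_left, min_eq_right, max_eq_left, max_eq_right, *] <;>
  first
  | (rw [max_eq_left (by linarith)]; linarith)
  | (rw [max_eq_right (by linarith)]; linarith)

lemma integral_indicator_Ioc {a b : ℝ} (ha : 0 ≤ a) (hab : a ≤ b) (hb : b ≤ 1) :
    ∫ x in Set.Icc (0 : ℝ) 1, (Set.Ioc a b).indicator (1 : ℝ → ℝ) x = b - a := by
  rw [integral_indicator_one measurableSet_Ioc, measureReal_restrict_apply measurableSet_Ioc,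
    Set.inter_eq_left.2 (show Set.Ioc a b ⊆ Set.Icc 0 1 from fun x hx =>
      ⟨ha.trans hx.1.le, hx.2.trans hb⟩), measureReal_def,
    Real.volume_Ioc, ENNReal.toReal_ofReal (by linarith)]

lemma Rect.integral_ind (R : Rect) : ∫ p, R.ind p ∂squareMeasure = (R.b - R.a) * (R.d - R.c) := by
  simp_rw [Rect.ind_eq_mul, squareMeasure_eq_prod]
  rw [integral_prod_mul, integral_indicator_Ioc R.ha R.hab R.hb,
    integral_indicator_Ioc R.hc R.hcd R.hd]

/-- The alternating sums of minima are left unsimplified because the same sums appear when the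
covariance of the bridge is expanded over the corners of two rectangles. -/
lemma Rect.integral_ind_mul (R R' : Rect) : ∫ p, R.ind p * R'.ind p ∂squareMeasure =
    (min R.b R'.b - min R.a R'.b - min R.b R'.a + min R.a R'.a) *
    (min R.d R'.d - min R.c R'.d - min R.d R'.c + min R.c R'.c) := by
  simp_rw [Rect.ind_eq_mul, squareMeasure_eq_prod]
  rw [← integral_indicator_Ioc_mul R.ha R.hab R.hb R'.hab,
    ← integral_indicator_Ioc_mul R.hc R.hcd R.hd R'.hcd, ← integral_prod_mul]
  congr 1; ext p; ring

/-- The variance of `f` under Lebesgue measure on the unit square. -/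
def sqVar (f : ℝ × ℝ → ℝ) : ℝ :=
  ∫ p, f p ^ 2 ∂squareMeasure - (∫ p, f p ∂squareMeasure) ^ 2

/-! ### Elementary integrals: isometry and Gaussian law -/

section Wiener

variable {Ω : Type*} [MeasurableSpace Ω] {P : Measure Ω} {B : ℝ → ℝ → Ω → ℝ}

lemma IsBivariateBrownianBridge.memLp (hB : IsBivariateBrownianBridge B P) {u v : ℝ}
    (hu : u ∈ Set.Icc (0 : ℝ) 1) (hv : v ∈ Set.Icc (0 : ℝ) 1) : MemLp (B u v) 2 P :=
  (hB.gaussian.hasGaussianLaw_eval (⟨u, hu⟩, ⟨v, hv⟩)).memLp_two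

lemma Rect.mem (R : Rect) : (R.a ∈ Set.Icc (0 : ℝ) 1 ∧ R.b ∈ Set.Icc (0 : ℝ) 1) ∧
    (R.c ∈ Set.Icc (0 : ℝ) 1 ∧ R.d ∈ Set.Icc (0 : ℝ) 1) :=
  ⟨⟨⟨R.ha, R.hab.trans R.hb⟩, ⟨R.ha.trans R.hab, R.hb⟩⟩,
    ⟨⟨R.hc, R.hcd.trans R.hd⟩, ⟨R.hc.trans R.hcd, R.hd⟩⟩⟩

lemma IsBivariateBrownianBridge.memLp_mass (hB : IsBivariateBrownianBridge B P) (R : Rect) :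
    MemLp (R.mass B) 2 P := by
  obtain ⟨⟨ha, hb⟩, hc, hd⟩ := R.mem
  exact (((hB.memLp hb hd).sub (hB.memLp ha hd)).sub (hB.memLp hb hc)).add (hB.memLp ha hc)

/-- The factor `X` is arbitrary so that the expansion can be used once for each of the two
rectangles in a covariance of masses. -/
lemma IsBivariateBrownianBridge.integral_mul_mass (hB : IsBivariateBrownianBridge B P) (R : Rect)
    {X : Ω → ℝ} (hX : MemLp X 2 P) :
    ∫ ω, X ω * R.mass B ω ∂P = ∫ ω, X ω * B R.b R.d ω ∂P - ∫ ω, X ω * B R.a R.d ω ∂P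
      - ∫ ω, X ω * B R.b R.c ω ∂P + ∫ ω, X ω * B R.a R.c ω ∂P := by
  obtain ⟨⟨ha, hb⟩, hc, hd⟩ := R.mem
  have h1 : Integrable (fun ω => X ω * B R.b R.d ω) P := hX.integrable_mul (hB.memLp hb hd)
  have h2 : Integrable (fun ω => X ω * B R.a R.d ω) P := hX.integrable_mul (hB.memLp ha hd)
  have h3 : Integrable (fun ω => X ω * B R.b R.c ω) P := hX.integrable_mul (hB.memLp hb hc)
  have h4 : Integrable (fun ω => X ω * B R.a R.c ω) P := hX.integrable_mul (hB.memLp ha hc)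
  rw [← integral_sub h1 h2, ← integral_sub (by exact h1.sub h2) h3,
    ← integral_add (by exact (h1.sub h2).sub h3) h4]
  congr 1; ext ω; simp only [Rect.mass]; ring

/-- The covariance of the masses of two rectangles. -/
lemma IsBivariateBrownianBridge.integral_mass_mul_mass (hB : IsBivariateBrownianBridge B P)
    (R R' : Rect) : ∫ ω, R.mass B ω * R'.mass B ω ∂P =
    ∫ p, R.ind p * R'.ind p ∂squareMeasure -
      (∫ p, R.ind p ∂squareMeasure) * ∫ p, R'.ind p ∂squareMeasure := by
  have key : ∀ u ∈ Set.Icc (0 : ℝ) 1, ∀ v ∈ Set.Icc (0 : ℝ) 1,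
      ∫ ω, R.mass B ω * B u v ω ∂P = (min R.b u - min R.a u) * (min R.d v - min R.c v) -
        (R.b - R.a) * (R.d - R.c) * u * v := by
    intro u hu v hv
    obtain ⟨⟨ha, hb⟩, hc, hd⟩ := R.mem
    simp_rw [mul_comm (R.mass B _)]
    rw [hB.integral_mul_mass R (hB.memLp hu hv), hB.covariance u hu v hv _ hb _ hd,
      hB.covariance u hu v hv _ ha _ hd, hB.covariance u hu v hv _ hb _ hc,
      hB.covariance u hu v hv _ ha _ hc]
    simp only [min_comm u, min_comm v]
    ring
  obtain ⟨⟨ha, hb⟩, hc, hd⟩ := R'.mem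
  rw [hB.integral_mul_mass R' (hB.memLp_mass R), key _ hb _ hd, key _ ha _ hd, key _ hb _ hc,
    key _ ha _ hc, R.integral_ind_mul, R.integral_ind, R'.integral_ind]
  ring

lemma IsBivariateBrownianBridge.integral_mass (hB : IsBivariateBrownianBridge B P)
    (R : Rect) : ∫ ω, R.mass B ω ∂P = 0 := by
  obtain ⟨⟨ha, hb⟩, hc, hd⟩ := R.mem
  have := hB.gaussian.isProbabilityMeasure
  have h1 := (hB.memLp hb hd).integrable one_le_two
  have h2 := (hB.memLp ha hd).integrable one_le_two
  have h3 := (hB.memLp hb hc).integrable one_le_two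
  have h4 := (hB.memLp ha hc).integrable one_le_two
  simp only [Rect.mass]
  rw [integral_add (by exact (h1.sub h2).sub h3) h4, integral_sub (by exact h1.sub h2) h3,
    integral_sub h1 h2, hB.centred _ hb _ hd, hB.centred _ ha _ hd, hB.centred _ hb _ hc,
    hB.centred _ ha _ hc]
  simp

lemma Step.eval_eq (s : Step) (p : ℝ × ℝ) : s.eval p = ∑ i, s.coef i * (s.rect i).ind p := rfl

@[fun_prop]
lemma Step.measurable_eval (s : Step) : Measurable s.eval := by
  have : s.eval = fun p => ∑ i, s.coef i * (s.rect i).ind p := rfl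
  rw [this]; fun_prop

lemma Rect.memLp_ind (R : Rect) : MemLp R.ind 2 squareMeasure :=
  MemLp.of_bound (by fun_prop) 1 (ae_of_all _ R.abs_ind_le)

lemma Step.memLp_eval (s : Step) : MemLp s.eval 2 squareMeasure :=
  memLp_finsetSum _ fun i _ => (s.rect i).memLp_ind.const_mul (s.coef i)

lemma IsBivariateBrownianBridge.memLp_integral (hB : IsBivariateBrownianBridge B P) (s : Step) :
    MemLp (s.integral B) 2 P :=
  memLp_finsetSum _ fun i _ => (hB.memLp_mass (s.rect i)).const_mul (s.coef i)

lemma IsBivariateBrownianBridge.mean_integral (hB : IsBivariateBrownianBridge B P) (s : Step) :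
    ∫ ω, s.integral B ω ∂P = 0 := by
  have := hB.gaussian.isProbabilityMeasure
  simp only [Step.integral]
  rw [integral_finsetSum _ fun i _ =>
    ((hB.memLp_mass (s.rect i)).integrable one_le_two).const_mul (s.coef i)]
  simp [integral_const_mul, hB.integral_mass]

/-- The isometry property of elementary integrals. -/
lemma IsBivariateBrownianBridge.integral_sq (hB : IsBivariateBrownianBridge B P) (s : Step) :
    ∫ ω, s.integral B ω ^ 2 ∂P = sqVar s.eval := by
  have e1 : ∀ ω, s.integral B ω ^ 2 = ∑ i, ∑ j, s.coef i * s.coef j *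
      ((s.rect i).mass B ω * (s.rect j).mass B ω) := by
    intro ω
    rw [Step.integral, sq, Finset.sum_mul_sum]
    exact Finset.sum_congr rfl fun i _ => Finset.sum_congr rfl fun j _ => by ring
  have e2 : ∀ p, s.eval p ^ 2 = ∑ i, ∑ j, s.coef i * s.coef j *
      ((s.rect i).ind p * (s.rect j).ind p) := by
    intro p
    rw [Step.eval_eq, sq, Finset.sum_mul_sum]
    exact Finset.sum_congr rfl fun i _ => Finset.sum_congr rfl fun j _ => by ring
  have i1 : ∀ i j, Integrable (fun ω => s.coef i * s.coef j *
      ((s.rect i).mass B ω * (s.rect j).mass B ω)) P := fun i j =>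
    ((hB.memLp_mass _).integrable_mul (hB.memLp_mass _)).const_mul _
  have i2 : ∀ i j, Integrable (fun p => s.coef i * s.coef j *
      ((s.rect i).ind p * (s.rect j).ind p)) squareMeasure := fun i j =>
    ((Rect.memLp_ind _).integrable_mul (Rect.memLp_ind _)).const_mul _
  have e3 : ∫ p, s.eval p ∂squareMeasure =
      ∑ i, s.coef i * ∫ p, (s.rect i).ind p ∂squareMeasure := by
    simp_rw [Step.eval_eq]
    rw [integral_finsetSum _ fun i _ =>
      ((Rect.memLp_ind _).integrable one_le_two).const_mul (s.coef i)]
    simp_rw [integral_const_mul]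
  rw [sqVar, e3, sq (∑ i, _), Finset.sum_mul_sum]
  simp_rw [e1, e2]
  rw [integral_finsetSum _ fun i _ => integrable_finsetSum _ fun j _ => i1 i j,
    integral_finsetSum _ fun i _ => integrable_finsetSum _ fun j _ => i2 i j,
    ← Finset.sum_sub_distrib]
  refine Finset.sum_congr rfl fun i _ => ?_
  rw [integral_finsetSum _ fun j _ => i1 i j, integral_finsetSum _ fun j _ => i2 i j,
    ← Finset.sum_sub_distrib]
  refine Finset.sum_congr rfl fun j _ => ?_
  rw [integral_const_mul, integral_const_mul, hB.integral_mass_mul_mass]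
  ring

/-- An elementary integral is a continuous linear functional of finitely many values of the bridge,
and such functionals preserve Gaussian laws. -/
lemma IsBivariateBrownianBridge.hasGaussianLaw_integral (hB : IsBivariateBrownianBridge B P)
    (s : Step) : HasGaussianLaw (s.integral B) P := by
  classical
  let T := Set.Icc (0 : ℝ) 1 × Set.Icc (0 : ℝ) 1
  let pt (i : Fin s.n) : Fin 4 → T := fun k =>
    match k with
    | 0 => (⟨_, (s.rect i).mem.1.2⟩, ⟨_, (s.rect i).mem.2.2⟩)
    | 1 => (⟨_, (s.rect i).mem.1.1⟩, ⟨_, (s.rect i).mem.2.2⟩)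
    | 2 => (⟨_, (s.rect i).mem.1.2⟩, ⟨_, (s.rect i).mem.2.1⟩)
    | 3 => (⟨_, (s.rect i).mem.1.1⟩, ⟨_, (s.rect i).mem.2.1⟩)
  -- Taking the image merges corners shared by several rectangles, so the joint law is indexed by
  -- distinct points.
  let I : Finset T := Finset.univ.image (fun q : Fin s.n × Fin 4 => pt q.1 q.2)
  have hI : ∀ i k, pt i k ∈ I := fun i k => Finset.mem_image_of_mem
    (fun q : Fin s.n × Fin 4 => pt q.1 q.2) (Finset.mem_univ (i, k))
  let e (i : Fin s.n) (k : Fin 4) : (I → ℝ) →L[ℝ] ℝ := ContinuousLinearMap.proj ⟨pt i k, hI i k⟩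
  let L : (I → ℝ) →L[ℝ] ℝ := ∑ i, s.coef i • (e i 0 - e i 1 - e i 2 + e i 3)
  have h := (hB.gaussian.hasGaussianLaw I).map L
  refine h.congr (ae_of_all _ fun ω => ?_)
  simp [L, e, pt, Step.integral, Rect.mass, Finset.restrict_def, mul_add]

lemma IsBivariateBrownianBridge.hasLaw_integral (hB : IsBivariateBrownianBridge B P)
    (s : Step) : HasLaw (s.integral B) (gaussianReal 0 (sqVar s.eval).toNNReal) P := by
  have h := hB.hasGaussianLaw_integral s
  refine ⟨h.aemeasurable, ?_⟩
  rw [h.map_eq_gaussianReal, hB.mean_integral,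
    variance_of_integral_eq_zero h.aemeasurable (hB.mean_integral s), ← hB.integral_sq s]

/-- Dominated convergence in `L²`. -/
lemma tendsto_eLpNorm_two_of_dominated {α : Type*} [MeasurableSpace α] {μ : Measure α}
    {F : ℕ → α → ℝ} {f bound : α → ℝ} (hF : ∀ n, AEStronglyMeasurable (F n) μ)
    (hbound : MemLp bound 2 μ) (h : ∀ n, ∀ᵐ x ∂μ, |F n x| ≤ bound x)
    (hlim : ∀ᵐ x ∂μ, Tendsto (fun n => F n x) atTop (𝓝 (f x))) :
    MemLp f 2 μ ∧ Tendsto (fun n => eLpNorm (fun x => F n x - f x) 2 μ) atTop (𝓝 0) := by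
  have hf : AEStronglyMeasurable f μ := aestronglyMeasurable_of_tendsto_ae _ hF hlim
  have hall := ae_all_iff.2 h
  have hfb : ∀ᵐ x ∂μ, |f x| ≤ bound x := by
    filter_upwards [hall, hlim] with x hx hl
    exact le_of_tendsto hl.abs (Eventually.of_forall hx)
  refine ⟨hbound.mono' hf hfb, ?_⟩
  simp_rw [eLpNorm_eq_lintegral_rpow_enorm_toReal (two_ne_zero) (ENNReal.ofNat_ne_top)]
  have key : Tendsto (fun n => ∫⁻ x, ‖F n x - f x‖ₑ ^ (2 : ℝ≥0∞).toReal ∂μ) atTop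
      (𝓝 (∫⁻ x, 0 ∂μ)) := by
    refine tendsto_lintegral_of_dominated_convergence'
      (fun x => ‖2 * bound x‖ₑ ^ (2 : ℝ≥0∞).toReal)
      (fun n => ((hF n).sub hf).enorm.pow_const _) ?_ ?_ ?_
    · intro n
      filter_upwards [h n, hfb] with x h1 h2
      refine ENNReal.rpow_le_rpow ?_ (by simp)
      rw [enorm_le_iff_norm_le, Real.norm_eq_abs, Real.norm_eq_abs]
      have h3 := abs_sub (F n x) (f x)
      have h4 := le_abs_self (2 * bound x)
      linarith
    · exact (lintegral_rpow_enorm_lt_top_of_eLpNorm_lt_top two_ne_zero ENNReal.ofNat_ne_top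
        (hbound.const_mul 2).2).ne
    · filter_upwards [hlim] with x hx
      have h1 : Tendsto (fun n => F n x - f x) atTop (𝓝 0) := by
        simpa using hx.sub_const (f x)
      have h2 : Tendsto (fun n => ‖F n x - f x‖ₑ) atTop (𝓝 0) := by
        simpa [Function.comp_def] using (continuous_enorm.tendsto (0 : ℝ)).comp h1
      have h3 := ((ENNReal.continuous_rpow_const (y := (2 : ℝ≥0∞).toReal)).tendsto 0).comp h2
      simpa [Function.comp_def] using h3
  have h3 := ((ENNReal.continuous_rpow_const (y := 1 / (2 : ℝ≥0∞).toReal)).tendsto _).comp key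
  simpa [Function.comp_def] using h3

/-- By the isometry the second moment is ∫s² - (∫s)²; dropping the subtracted square leaves the
contraction. -/
lemma IsBivariateBrownianBridge.eLpNorm_integral_le (hB : IsBivariateBrownianBridge B P)
    (s : Step) : eLpNorm (s.integral B) 2 P ≤ eLpNorm s.eval 2 squareMeasure := by
  rw [(hB.memLp_integral s).eLpNorm_eq_integral_rpow_norm two_ne_zero ENNReal.ofNat_ne_top,
    s.memLp_eval.eLpNorm_eq_integral_rpow_norm two_ne_zero ENNReal.ofNat_ne_top]
  refine ENNReal.ofReal_le_ofReal (Real.rpow_le_rpow (by positivity) ?_ (by simp))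
  simp only [ENNReal.toReal_ofNat, Real.rpow_ofNat, Real.norm_eq_abs, sq_abs]
  rw [hB.integral_sq, sqVar]
  linarith [sq_nonneg (∫ p, s.eval p ∂squareMeasure)]

/-! ### The Wiener integral as a closed linear contraction -/

/-- The sum of two step functions. -/
def Step.add (s t : Step) : Step where
  n := s.n + t.n
  coef := Fin.append s.coef t.coef
  rect := Fin.append s.rect t.rect

lemma Step.eval_add (s t : Step) (p : ℝ × ℝ) : (s.add t).eval p = s.eval p + t.eval p := by
  change ∑ i : Fin (s.n + t.n), Fin.append s.coef t.coef i *
    (Fin.append s.rect t.rect i).toSet.indicator (fun _ => (1 : ℝ)) p = _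
  simp [Step.eval, Fin.sum_univ_add]

lemma Step.integral_add {Ω' : Type*} {B : ℝ → ℝ → Ω' → ℝ} (s t : Step) (ω : Ω') :
    (s.add t).integral B ω = s.integral B ω + t.integral B ω := by
  change ∑ i : Fin (s.n + t.n), Fin.append s.coef t.coef i *
    (Fin.append s.rect t.rect i).mass B ω = _
  simp [Step.integral, Fin.sum_univ_add]

/-- A multiple of a step function. -/
def Step.smul (c : ℝ) (s : Step) : Step where
  n := s.n
  coef := fun i => c * s.coef i
  rect := s.rect

lemma Step.eval_smul (c : ℝ) (s : Step) (p : ℝ × ℝ) : (s.smul c).eval p = c * s.eval p := by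
  rw [Step.eval, Step.eval, Finset.mul_sum]
  exact Finset.sum_congr rfl fun i _ => mul_assoc _ _ _

lemma Step.integral_smul {Ω' : Type*} {B : ℝ → ℝ → Ω' → ℝ} (c : ℝ) (s : Step) (ω : Ω') :
    (s.smul c).integral B ω = c * s.integral B ω := by
  rw [Step.integral, Step.integral, Finset.mul_sum]
  exact Finset.sum_congr rfl fun i _ => mul_assoc _ _ _

namespace HasStochIntegral

variable {f f' : ℝ × ℝ → ℝ} {J J' : Ω → ℝ}

lemma congr (h : HasStochIntegral P B f J) (hf : f =ᵐ[squareMeasure] f') (hJ : J =ᵐ[P] J') :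
    HasStochIntegral P B f' J' := by
  obtain ⟨h1, h2, s, h3, h4⟩ := h
  refine ⟨(memLp_congr_ae hf).1 h1, (memLp_congr_ae hJ).1 h2, s, ?_, ?_⟩
  · refine h3.congr fun n => eLpNorm_congr_ae ?_
    filter_upwards [hf] with p hp
    rw [hp]
  · refine h4.congr fun n => eLpNorm_congr_ae ?_
    filter_upwards [hJ] with p hp
    rw [hp]

lemma add (hB : IsBivariateBrownianBridge B P) (h : HasStochIntegral P B f J)
    (h' : HasStochIntegral P B f' J') :
    HasStochIntegral P B (fun p => f p + f' p) (fun ω => J ω + J' ω) := by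
  obtain ⟨h1, h2, s, h3, h4⟩ := h
  obtain ⟨h1', h2', s', h3', h4'⟩ := h'
  refine ⟨h1.add h1', h2.add h2', fun n => (s n).add (s' n), ?_, ?_⟩
  · have h0 := h3.add h3'
    rw [add_zero] at h0
    refine tendsto_of_tendsto_of_tendsto_of_le_of_le tendsto_const_nhds h0 (fun _ => zero_le)
      fun n => ?_
    refine le_trans (le_of_eq ?_) (eLpNorm_add_le (((s n).memLp_eval.sub h1).aestronglyMeasurable)
      (((s' n).memLp_eval.sub h1').aestronglyMeasurable) one_le_two)
    congr 1; ext p; simp only [Step.eval_add, Pi.add_apply]; ring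
  · have h0 := h4.add h4'
    rw [add_zero] at h0
    refine tendsto_of_tendsto_of_tendsto_of_le_of_le tendsto_const_nhds h0 (fun _ => zero_le)
      fun n => ?_
    refine le_trans (le_of_eq ?_) (eLpNorm_add_le
      (((hB.memLp_integral (s n)).sub h2).aestronglyMeasurable)
      (((hB.memLp_integral (s' n)).sub h2').aestronglyMeasurable) one_le_two)
    congr 1; ext p; simp only [Step.integral_add, Pi.add_apply]; ring

lemma const_mul (c : ℝ) (h : HasStochIntegral P B f J) :
    HasStochIntegral P B (fun p => c * f p) (fun ω => c * J ω) := by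
  obtain ⟨h1, h2, s, h3, h4⟩ := h
  refine ⟨h1.const_mul c, h2.const_mul c, fun n => (s n).smul c, ?_, ?_⟩
  · have h0 := ENNReal.Tendsto.const_mul (a := ‖c‖ₑ) h3 (Or.inr (by simp))
    rw [mul_zero] at h0
    refine h0.congr fun n => ?_
    rw [← eLpNorm_const_smul]
    congr 1; ext p; simp only [Step.eval_smul, Pi.smul_apply, smul_eq_mul]; ring
  · have h0 := ENNReal.Tendsto.const_mul (a := ‖c‖ₑ) h4 (Or.inr (by simp))
    rw [mul_zero] at h0
    refine h0.congr fun n => ?_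
    rw [← eLpNorm_const_smul]
    congr 1; ext p; simp only [Step.integral_smul, Pi.smul_apply, smul_eq_mul]; ring

lemma sub (hB : IsBivariateBrownianBridge B P) (h : HasStochIntegral P B f J)
    (h' : HasStochIntegral P B f' J') :
    HasStochIntegral P B (fun p => f p - f' p) (fun ω => J ω - J' ω) := by
  refine (h.add hB (h'.const_mul (-1))).congr (ae_of_all _ fun p => ?_) (ae_of_all _ fun ω => ?_) <;>
  simp only <;> ring

lemma of_step (hB : IsBivariateBrownianBridge B P) (s : Step) :
    HasStochIntegral P B s.eval (s.integral B) :=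
  ⟨s.memLp_eval, hB.memLp_integral s, fun _ => s, by simp, by simp⟩

lemma of_rect (hB : IsBivariateBrownianBridge B P) (R : Rect) :
    HasStochIntegral P B R.ind (R.mass B) := by
  refine (of_step hB ⟨1, fun _ => 1, fun _ => R⟩).congr (ae_of_all _ fun p => ?_)
    (ae_of_all _ fun ω => ?_)
  · simp [Step.eval_eq]
  · simp [Step.integral]

lemma sum (hB : IsBivariateBrownianBridge B P) {ι : Type*} (s : Finset ι) {f : ι → ℝ × ℝ → ℝ}
    {J : ι → Ω → ℝ} (h : ∀ i ∈ s, HasStochIntegral P B (f i) (J i)) :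
    HasStochIntegral P B (fun p => ∑ i ∈ s, f i p) (fun ω => ∑ i ∈ s, J i ω) := by
  classical
  induction s using Finset.induction_on with
  | empty =>
    refine (of_step hB ⟨0, fun _ => 0, Fin.elim0⟩).congr (ae_of_all _ fun p => ?_)
      (ae_of_all _ fun ω => ?_)
    · simp [Step.eval_eq]
    · simp [Step.integral]
  | insert a s ha ih =>
    simp_rw [Finset.sum_insert ha]
    exact (h a (Finset.mem_insert_self _ _)).add hB
      (ih fun i hi => h i (Finset.mem_insert_of_mem hi))

/-- The stochastic integral is a contraction. -/
lemma eLpNorm_le (hB : IsBivariateBrownianBridge B P) (h : HasStochIntegral P B f J) :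
    eLpNorm J 2 P ≤ eLpNorm f 2 squareMeasure := by
  obtain ⟨h1, h2, s, h3, h4⟩ := h
  have h0 := (h4.add h3).add_const (eLpNorm f 2 squareMeasure)
  simp only [add_zero, zero_add] at h0
  refine ge_of_tendsto h0 (Eventually.of_forall fun n => ?_)
  have e1 : eLpNorm J 2 P ≤ eLpNorm (fun ω => (s n).integral B ω - J ω) 2 P +
      eLpNorm ((s n).integral B) 2 P := by
    rw [← eLpNorm_neg (fun ω => (s n).integral B ω - J ω)]
    refine le_trans (le_of_eq ?_) (eLpNorm_add_le
      ((hB.memLp_integral (s n)).sub h2).neg.aestronglyMeasurable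
      (hB.memLp_integral (s n)).aestronglyMeasurable one_le_two)
    congr 1; ext ω; simp
  have e2 : eLpNorm (s n).eval 2 squareMeasure ≤
      eLpNorm (fun p => (s n).eval p - f p) 2 squareMeasure + eLpNorm f 2 squareMeasure := by
    refine le_trans (le_of_eq ?_) (eLpNorm_add_le
      ((s n).memLp_eval.sub h1).aestronglyMeasurable h1.aestronglyMeasurable one_le_two)
    congr 1; ext ω; simp
  calc _ ≤ _ := e1
    _ ≤ eLpNorm (fun ω => (s n).integral B ω - J ω) 2 P +
      (eLpNorm (fun p => (s n).eval p - f p) 2 squareMeasure + eLpNorm f 2 squareMeasure) := by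
        gcongr; exact (hB.eLpNorm_integral_le _).trans e2
    _ = _ := by rw [add_assoc]

/-- By linearity the difference integrates 0, and the contraction makes its norm vanish. It is
therefore enough to exhibit one version of each Wiener integral. -/
lemma unique (hB : IsBivariateBrownianBridge B P) (h : HasStochIntegral P B f J)
    (h' : HasStochIntegral P B f J') : J =ᵐ[P] J' := by
  have h0 := (h.sub hB h').eLpNorm_le hB
  simp only [sub_self, eLpNorm_zero', nonpos_iff_eq_zero] at h0
  replace h0 := (eLpNorm_eq_zero_iff (h.2.1.sub h'.2.1).aestronglyMeasurable two_ne_zero).1 h0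
  filter_upwards [h0] with ω hω
  exact sub_eq_zero.1 hω

/-- The stochastic integral is a closed operator. -/
lemma of_tendsto (hB : IsBivariateBrownianBridge B P) {f : ℕ → ℝ × ℝ → ℝ} {f' : ℝ × ℝ → ℝ}
    {J : ℕ → Ω → ℝ} {J' : Ω → ℝ} (h : ∀ n, HasStochIntegral P B (f n) (J n))
    (hf' : MemLp f' 2 squareMeasure)
    (hf : Tendsto (fun n => eLpNorm (fun p => f n p - f' p) 2 squareMeasure) atTop (𝓝 0))
    (hJ : ∀ᵐ ω ∂P, Tendsto (fun n => J n ω) atTop (𝓝 (J' ω))) :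
    HasStochIntegral P B f' J' := by
  have hJm : AEStronglyMeasurable J' P :=
    aestronglyMeasurable_of_tendsto_ae _ (fun n => (h n).2.1.aestronglyMeasurable) hJ
  have hJJ : Tendsto (fun n => eLpNorm (fun ω => J n ω - J' ω) 2 P) atTop (𝓝 0) := by
    rw [ENNReal.tendsto_atTop_zero] at hf ⊢
    intro ε hε
    obtain ⟨N, hN⟩ := hf (ε / 2) (ENNReal.half_pos hε.ne')
    refine ⟨N, fun n hn => ?_⟩
    -- The contraction makes `J` Cauchy in `L²`; letting m tend to infinity, lower semicontinuity of
    -- the norm upgrades almost sure convergence to `L²` convergence.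
    refine Lp.eLpNorm_le_of_ae_tendsto (u := atTop) (f := fun m ω => J n ω - J m ω) ?_
      (fun m => ((h n).2.1.sub (h m).2.1).aestronglyMeasurable) ?_
    · filter_upwards [eventually_ge_atTop N] with m hm
      refine (((h n).sub hB (h m)).eLpNorm_le hB).trans ?_
      have e := eLpNorm_sub_le ((h n).1.sub hf').aestronglyMeasurable
        ((h m).1.sub hf').aestronglyMeasurable one_le_two
      refine le_trans (le_of_eq ?_) (e.trans ((add_le_add (hN n hn) (hN m hm)).trans
        (ENNReal.add_halves ε).le))
      congr 1; ext p; simp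
    · filter_upwards [hJ] with ω hω
      exact hω.const_sub _
  have hJ' : MemLp J' 2 P := by
    obtain ⟨n, hn⟩ := (hJJ.eventually (gt_mem_nhds (zero_lt_one))).exists
    have e : MemLp (fun ω => J n ω - J' ω) 2 P :=
      ⟨(h n).2.1.aestronglyMeasurable.sub hJm, hn.trans ENNReal.one_lt_top⟩
    refine ((h n).2.1.sub e).congr_norm hJm (ae_of_all _ fun ω => ?_)
    simp
  -- Diagonal choice of approximants with error 1/n; for n = 0 the bound is ∞, hence harmless.
  have hstep : ∀ n, ∃ s : Step, eLpNorm (fun p => s.eval p - f n p) 2 squareMeasure ≤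
      ((n : ℝ≥0∞))⁻¹ ∧ eLpNorm (fun ω => s.integral B ω - J n ω) 2 P ≤ ((n : ℝ≥0∞))⁻¹ := by
    intro n
    obtain ⟨-, -, s, h3, h4⟩ := h n
    have hp : (0 : ℝ≥0∞) < ((n : ℝ≥0∞))⁻¹ := by simp
    obtain ⟨k, hk1, hk2⟩ := ((h3.eventually (ge_mem_nhds hp)).and
      (h4.eventually (ge_mem_nhds hp))).exists
    exact ⟨s k, hk1, hk2⟩
  choose s hs1 hs2 using hstep
  refine ⟨hf', hJ', s, ?_, ?_⟩
  · have h0 := ENNReal.tendsto_inv_nat_nhds_zero.add hf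
    rw [add_zero] at h0
    refine tendsto_of_tendsto_of_tendsto_of_le_of_le tendsto_const_nhds h0 (fun _ => zero_le)
      fun n => ?_
    refine le_trans (le_of_eq ?_) ((eLpNorm_add_le
      ((s n).memLp_eval.sub (h n).1).aestronglyMeasurable
      ((h n).1.sub hf').aestronglyMeasurable one_le_two).trans (add_le_add (hs1 n) le_rfl))
    congr 1; ext p; simp
  · have h0 := ENNReal.tendsto_inv_nat_nhds_zero.add hJJ
    rw [add_zero] at h0
    refine tendsto_of_tendsto_of_tendsto_of_le_of_le tendsto_const_nhds h0 (fun _ => zero_le)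
      fun n => ?_
    refine le_trans (le_of_eq ?_) ((eLpNorm_add_le
      ((hB.memLp_integral (s n)).sub (h n).2.1).aestronglyMeasurable
      ((h n).2.1.sub hJ').aestronglyMeasurable one_le_two).trans (add_le_add (hs2 n) le_rfl))
    congr 1; ext p; simp

end HasStochIntegral

/-! ### Gaussian law of the Wiener integral -/

lemma integral_mul_eq_inner {α : Type*} [MeasurableSpace α] {μ : Measure α} {f g : α → ℝ}
    (hf : MemLp f 2 μ) (hg : MemLp g 2 μ) :
    ∫ x, f x * g x ∂μ = inner ℝ (hg.toLp g) (hf.toLp f) := by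
  rw [L2.inner_def]
  refine integral_congr_ae ?_
  filter_upwards [hf.coeFn_toLp, hg.coeFn_toLp] with x h1 h2
  rw [h1, h2]; rfl

/-- Written with `L²` inner products, `sqVar` is ⟨f,f⟩ - ⟨1,f⟩², so its continuity is that of the
inner product. -/
lemma tendsto_sqVar {f : ℕ → ℝ × ℝ → ℝ} {f' : ℝ × ℝ → ℝ} (h : ∀ n, MemLp (f n) 2 squareMeasure)
    (h' : MemLp f' 2 squareMeasure)
    (hf : Tendsto (fun n => eLpNorm (fun p => f n p - f' p) 2 squareMeasure) atTop (𝓝 0)) :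
    Tendsto (fun n => sqVar (f n)) atTop (𝓝 (sqVar f')) := by
  have hL := (Lp.tendsto_Lp_iff_tendsto_eLpNorm'' f h f' h').2 hf
  have h1 : MemLp (fun _ : ℝ × ℝ => (1 : ℝ)) 2 squareMeasure := memLp_const 1
  have e : ∀ {g : ℝ × ℝ → ℝ} (hg : MemLp g 2 squareMeasure), sqVar g =
      inner ℝ (hg.toLp g) (hg.toLp g) - (inner ℝ (h1.toLp _) (hg.toLp g)) ^ 2 := by
    intro g hg
    rw [← integral_mul_eq_inner, ← integral_mul_eq_inner, sqVar]
    simp [sq]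
  rw [e h']
  refine Tendsto.congr (fun n => (e (h n)).symm) ?_
  exact (hL.inner hL).sub ((tendsto_const_nhds.inner hL).pow 2)

/-- The stochastic integral of `f` is a centred Gaussian variable with variance `sqVar f`. -/
lemma HasStochIntegral.hasLaw (hB : IsBivariateBrownianBridge B P) {f : ℝ × ℝ → ℝ} {J : Ω → ℝ}
    (h : HasStochIntegral P B f J) : HasLaw J (gaussianReal 0 (sqVar f).toNNReal) P := by
  obtain ⟨h1, h2, s, h3, h4⟩ := h
  have hP := hB.gaussian.isProbabilityMeasure
  have hJ := h2.aestronglyMeasurable.aemeasurable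
  have := Measure.isProbabilityMeasure_map (μ := P) hJ
  refine ⟨hJ, Measure.ext_of_charFun ?_⟩
  ext t
  have hv := tendsto_sqVar (fun n => (s n).memLp_eval) h1 h3
  -- A subsequence converges almost surely; along it the characteristic functions tend both to that
  -- of `J` and to the Gaussian one.
  have hm : TendstoInMeasure P (fun n => (s n).integral B) atTop J :=
    tendstoInMeasure_of_tendsto_eLpNorm two_ne_zero
      (fun n => (hB.memLp_integral (s n)).aestronglyMeasurable) h2.aestronglyMeasurable h4
  obtain ⟨ns, hns, hlim⟩ := hm.exists_seq_tendsto_ae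
  have e1 : Tendsto (fun k => charFun (P.map ((s (ns k)).integral B)) t) atTop
      (𝓝 (charFun (P.map J) t)) := by
    have hc : ∀ {X : Ω → ℝ}, AEMeasurable X P →
        charFun (P.map X) t = ∫ ω, Complex.exp (t * X ω * Complex.I) ∂P := by
      intro X hX
      rw [charFun_apply_real, integral_map hX (by fun_prop)]
    rw [hc hJ]
    simp_rw [hc (hB.memLp_integral _).aestronglyMeasurable.aemeasurable]
    refine tendsto_integral_of_dominated_convergence (fun _ => 1) (fun n => ?_)
      (integrable_const _) (fun n => ae_of_all _ fun ω => ?_) ?_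
    · have := (hB.memLp_integral (s (ns n))).aestronglyMeasurable.aemeasurable
      exact AEMeasurable.aestronglyMeasurable (by fun_prop)
    · rw [← Complex.ofReal_mul, Complex.norm_exp_ofReal_mul_I]
    · filter_upwards [hlim] with ω hω
      have hcont : Continuous fun x : ℝ => Complex.exp (t * x * Complex.I) := by fun_prop
      exact (hcont.tendsto _).comp hω
  have e2 : Tendsto (fun k => charFun (P.map ((s (ns k)).integral B)) t) atTop
      (𝓝 (charFun (gaussianReal 0 (sqVar f).toNNReal) t)) := by
    simp_rw [(hB.hasLaw_integral _).map_eq, charFun_gaussianReal]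
    have h5 : Tendsto (fun k => (((sqVar (s (ns k)).eval).toNNReal : ℝ) : ℂ)) atTop
        (𝓝 (((sqVar f).toNNReal : ℝ) : ℂ)) :=
      ((Complex.continuous_ofReal.comp (NNReal.continuous_coe.comp
        continuous_real_toNNReal)).tendsto _).comp (hv.comp hns.tendsto_atTop)
    have hcont : Continuous fun v : ℂ => Complex.exp (t * (0 : ℝ) * Complex.I - v * t ^ 2 / 2) := by
      fun_prop
    exact (hcont.tendsto _).comp h5
  exact tendsto_nhds_unique e1 e2

/-! ### Riemann sums and stochastic Fubini on the unit square -/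

lemma tendsto_floor_div (x : ℝ) :
    Tendsto (fun N : ℕ => ((⌊((N : ℝ) + 1) * x⌋ : ℝ)) / ((N : ℝ) + 1)) atTop (𝓝 x) := by
  have h : Tendsto (fun N : ℕ => x - 1 / ((N : ℝ) + 1)) atTop (𝓝 x) := by
    simpa using (tendsto_one_div_add_atTop_nhds_zero_nat (𝕜 := ℝ)).const_sub x
  refine tendsto_of_tendsto_of_tendsto_of_le_of_le h tendsto_const_nhds (fun N => ?_) fun N => ?_
  · have hN : (0 : ℝ) < (N : ℝ) + 1 := by positivity
    have := Int.lt_floor_add_one (((N : ℝ) + 1) * x)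
    simp only
    rw [le_div_iff₀ hN, sub_mul, one_div, inv_mul_cancel₀ hN.ne']
    linarith
  · have hN : (0 : ℝ) < (N : ℝ) + 1 := by positivity
    simp only
    rw [div_le_iff₀ hN, mul_comm x]
    exact Int.floor_le _

/-- Riemann sums of a bounded almost everywhere continuous function on `[0,1]`. -/
lemma tendsto_riemannSum {φ : ℝ → ℝ} {M : ℝ} (hM : ∀ x ∈ Set.Icc (0 : ℝ) 1, |φ x| ≤ M)
    (hφ : ∀ᵐ x ∂(volume.restrict (Set.Icc (0 : ℝ) 1)), ContinuousAt φ x) :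
    Tendsto (fun N : ℕ => ((N : ℝ) + 1)⁻¹ * ∑ i ∈ Finset.range (N + 1), φ (i / ((N : ℝ) + 1)))
      atTop (𝓝 (∫ x in (0 : ℝ)..1, φ x)) := by
  -- The Riemann sum is the integral of this step function. It factors through ℤ, so no
  -- measurability of φ is needed, and dominated convergence finishes.
  have hmeas : ∀ N : ℕ, Measurable fun x : ℝ => φ ((⌊((N : ℝ) + 1) * x⌋ : ℝ) / ((N : ℝ) + 1)) := by
    intro N
    have h1 : Measurable fun k : ℤ => φ ((k : ℝ) / ((N : ℝ) + 1)) := measurable_from_top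
    exact h1.comp (Int.measurable_floor.comp (measurable_const.mul measurable_id))
  have hcongr : ∀ (N i : ℕ), Set.EqOn (fun _ => φ (i / ((N : ℝ) + 1)))
      (fun x => φ ((⌊((N : ℝ) + 1) * x⌋ : ℝ) / ((N : ℝ) + 1)))
      (Set.Ioo ((i : ℝ) / ((N : ℝ) + 1)) (((i + 1 : ℕ) : ℝ) / ((N : ℝ) + 1))) := by
    intro N i x hx
    have hN : (0 : ℝ) < (N : ℝ) + 1 := by positivity
    have : ⌊((N : ℝ) + 1) * x⌋ = (i : ℤ) := by
      rw [Int.floor_eq_iff]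
      have h1 := (div_lt_iff₀ hN).1 hx.1
      have h2 := (lt_div_iff₀ hN).1 hx.2
      push_cast at h2 ⊢
      constructor <;> linarith
    simp only [this, Int.cast_natCast]
  have hsum : ∀ N : ℕ, ∫ x in (0 : ℝ)..1, φ ((⌊((N : ℝ) + 1) * x⌋ : ℝ) / ((N : ℝ) + 1)) =
      ((N : ℝ) + 1)⁻¹ * ∑ i ∈ Finset.range (N + 1), φ (i / ((N : ℝ) + 1)) := by
    intro N
    have hN : (0 : ℝ) < (N : ℝ) + 1 := by positivity
    have hle : ∀ i : ℕ, (i : ℝ) / ((N : ℝ) + 1) ≤ ((i + 1 : ℕ) : ℝ) / ((N : ℝ) + 1) := by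
      intro i; gcongr; simp
    have h := intervalIntegral.sum_integral_adjacent_intervals (μ := volume)
      (f := fun x => φ ((⌊((N : ℝ) + 1) * x⌋ : ℝ) / ((N : ℝ) + 1)))
      (a := fun i : ℕ => (i : ℝ) / ((N : ℝ) + 1)) (n := N + 1) (fun i _ => by
        rw [intervalIntegrable_iff_integrableOn_Ioo_of_le (hle i)]
        refine IntegrableOn.congr_fun (f := fun _ => φ (i / ((N : ℝ) + 1)))
          (integrableOn_const (by simp)) (hcongr N i) measurableSet_Ioo)
    simp only [Nat.cast_zero, zero_div, Nat.cast_add, Nat.cast_one, div_self hN.ne'] at h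
    rw [← h, Finset.mul_sum]
    refine Finset.sum_congr rfl fun i _ => ?_
    have h2 : ∫ x in (i : ℝ) / ((N : ℝ) + 1)..((i + 1 : ℕ) : ℝ) / ((N : ℝ) + 1),
        φ ((⌊((N : ℝ) + 1) * x⌋ : ℝ) / ((N : ℝ) + 1)) =
        ∫ x in (i : ℝ) / ((N : ℝ) + 1)..((i + 1 : ℕ) : ℝ) / ((N : ℝ) + 1),
          φ (i / ((N : ℝ) + 1)) := by
      rw [intervalIntegral.integral_of_le (hle i), intervalIntegral.integral_of_le (hle i),
        integral_Ioc_eq_integral_Ioo, integral_Ioc_eq_integral_Ioo]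
      exact (setIntegral_congr_fun measurableSet_Ioo (hcongr N i)).symm
    push_cast at h2
    rw [h2, intervalIntegral.integral_const, smul_eq_mul]
    field_simp
    ring
  simp_rw [← hsum]
  refine intervalIntegral.tendsto_integral_filter_of_dominated_convergence (fun _ => M)
    (Eventually.of_forall fun N => (hmeas N).aestronglyMeasurable)
    (Eventually.of_forall fun N => ae_of_all _ fun x hx => ?_) (by simp) ?_
  · rw [Set.uIoc_of_le zero_le_one] at hx
    have hN : (0 : ℝ) < (N : ℝ) + 1 := by positivity
    refine hM _ ⟨div_nonneg ?_ hN.le, ?_⟩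
    · exact_mod_cast Int.floor_nonneg.2 (mul_nonneg hN.le hx.1.le)
    · rw [div_le_one hN]
      exact (Int.floor_le _).trans (mul_le_of_le_one_right hN.le hx.2)
  · rw [ae_restrict_iff' measurableSet_Icc] at hφ
    filter_upwards [hφ] with x hx hx'
    rw [Set.uIoc_of_le zero_le_one] at hx'
    exact (hx ⟨hx'.1.le, hx'.2⟩).tendsto.comp (tendsto_floor_div x)

/-- A stochastic Fubini theorem: averaging over a parameter in `[0,1]`. -/
lemma HasStochIntegral.average (hB : IsBivariateBrownianBridge B P) {f : ℝ → ℝ × ℝ → ℝ}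
    {J : ℝ → Ω → ℝ} {M : ℝ} (h : ∀ x ∈ Set.Icc (0 : ℝ) 1, HasStochIntegral P B (f x) (J x))
    (hJ : ∀ᵐ ω ∂P, Continuous fun x => J x ω)
    (hM : ∀ x ∈ Set.Icc (0 : ℝ) 1, ∀ p, |f x p| ≤ M)
    (hf : ∀ᵐ p ∂squareMeasure, ∀ᵐ x ∂(volume.restrict (Set.Icc (0 : ℝ) 1)),
      ContinuousAt (fun x => f x p) x) :
    HasStochIntegral P B (fun p => ∫ x in (0 : ℝ)..1, f x p)
      (fun ω => ∫ x in (0 : ℝ)..1, J x ω) := by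
  have hmem : ∀ N i : ℕ, i ∈ Finset.range (N + 1) →
      (i : ℝ) / ((N : ℝ) + 1) ∈ Set.Icc (0 : ℝ) 1 := by
    intro N i hi
    have h1 : (i : ℝ) ≤ N := by exact_mod_cast Nat.lt_succ_iff.1 (Finset.mem_range.1 hi)
    refine ⟨by positivity, ?_⟩
    rw [div_le_one (by positivity)]
    linarith
  -- Riemann sums in the parameter are finite combinations of Wiener integrals. They converge
  -- boundedly on the integrand side and pathwise on the random side, so closedness applies.
  have hN : ∀ N : ℕ, HasStochIntegral P B
      (fun p => ((N : ℝ) + 1)⁻¹ * ∑ i ∈ Finset.range (N + 1), f (i / ((N : ℝ) + 1)) p)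
      (fun ω => ((N : ℝ) + 1)⁻¹ * ∑ i ∈ Finset.range (N + 1), J (i / ((N : ℝ) + 1)) ω) :=
    fun N => HasStochIntegral.const_mul _
      (HasStochIntegral.sum hB _ fun i hi => h _ (hmem N i hi))
  have hL := tendsto_eLpNorm_two_of_dominated (μ := squareMeasure) (bound := fun _ => M)
    (fun N => (hN N).1.aestronglyMeasurable) (memLp_const _)
    (fun N => ae_of_all _ fun p => by
      rw [abs_mul, abs_of_pos (by positivity : (0 : ℝ) < ((N : ℝ) + 1)⁻¹),
        inv_mul_le_iff₀ (by positivity)]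
      refine (Finset.abs_sum_le_sum_abs _ _).trans ?_
      refine (Finset.sum_le_sum fun i hi => hM _ (hmem N i hi) p).trans ?_
      simp)
    (by
      filter_upwards [hf] with p hp
      exact tendsto_riemannSum (fun x hx => hM x hx p) hp)
  refine HasStochIntegral.of_tendsto hB hN hL.1 hL.2 ?_
  filter_upwards [hJ] with ω hω
  obtain ⟨C, hC⟩ := isCompact_Icc.exists_bound_of_continuousOn (hω.continuousOn (s := Set.Icc 0 1))
  exact tendsto_riemannSum hC (ae_of_all _ fun x => hω.continuousAt)

/-- The indicator function of `(s, ∞)`. -/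
def stepInd (s v : ℝ) : ℝ := (Set.Ioi s).indicator 1 v

lemma stepInd_of_lt {s v : ℝ} (h : s < v) : stepInd s v = 1 := by
  simp [stepInd, h]

lemma stepInd_of_le {s v : ℝ} (h : v ≤ s) : stepInd s v = 0 := by
  simp [stepInd, h]

lemma stepInd_nonneg (s v : ℝ) : 0 ≤ stepInd s v :=
  Set.indicator_nonneg (fun _ _ => zero_le_one) _

lemma stepInd_le_one (s v : ℝ) : stepInd s v ≤ 1 := by
  rcases lt_or_ge s v with h | h
  · rw [stepInd_of_lt h]
  · rw [stepInd_of_le h]; exact zero_le_one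

lemma measurable_stepInd : Measurable (Function.uncurry stepInd) := by
  have : Function.uncurry stepInd = {p : ℝ × ℝ | p.1 < p.2}.indicator 1 := by
    ext p; simp [Function.uncurry, stepInd, Set.indicator_apply]
  rw [this]
  exact measurable_one.indicator (measurableSet_lt measurable_fst measurable_snd)

lemma continuousAt_stepInd {g : ℝ → ℝ} (hg : Continuous g) {x v : ℝ} (h : g x ≠ v) :
    ContinuousAt (fun x => stepInd (g x) v) x := by
  rcases lt_or_gt_of_ne h with h | h
  · refine (continuousAt_const (y := (1 : ℝ))).congr ?_
    filter_upwards [hg.continuousAt.eventually (gt_mem_nhds h)] with y hy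
    rw [stepInd_of_lt hy]
  · refine (continuousAt_const (y := (0 : ℝ))).congr ?_
    filter_upwards [hg.continuousAt.eventually (lt_mem_nhds h)] with y hy
    rw [stepInd_of_le (le_of_lt hy)]

/-- Level sets are disjoint, so only countably many have positive measure. For every other level v,
x ↦ `stepInd (g x) v` is continuous at almost every x, as Riemann sums require. -/
lemma ae_ae_ne {g : ℝ → ℝ} (hg : Continuous g) :
    ∀ᵐ v : ℝ, ∀ᵐ x ∂(volume.restrict (Set.Icc (0 : ℝ) 1)), g x ≠ v := by
  have h := Measure.countable_meas_level_set_pos (μ := volume.restrict (Set.Icc (0 : ℝ) 1))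
    hg.measurable
  filter_upwards [h.ae_notMem volume] with v hv
  have h0 : (volume.restrict (Set.Icc (0 : ℝ) 1)) {x | g x = v} = 0 := by
    simpa using hv
  rw [ae_iff]
  simpa using h0

/-- The mass of `(s, 1] × (t, 1]`. -/
def corner {Ω : Type*} (B : ℝ → ℝ → Ω → ℝ) (s t : ℝ) (ω : Ω) : ℝ :=
  B 1 1 ω - B s 1 ω - B 1 t ω + B s t ω

/-- The rectangle `(s, 1] × (t, 1]`. -/
def cornerRect {s t : ℝ} (hs : s ∈ Set.Icc (0 : ℝ) 1) (ht : t ∈ Set.Icc (0 : ℝ) 1) : Rect :=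
  ⟨s, 1, t, 1, hs.1, hs.2, le_rfl, ht.1, ht.2, le_rfl⟩

lemma ae_mem_square : ∀ᵐ p ∂squareMeasure, p ∈ Set.Icc (0 : ℝ) 1 ×ˢ Set.Icc (0 : ℝ) 1 :=
  ae_restrict_mem (measurableSet_Icc.prod measurableSet_Icc)

lemma ae_square_fst {q : ℝ → Prop} (h : ∀ᵐ v, q v) : ∀ᵐ p ∂squareMeasure, q p.1 := by
  rw [squareMeasure_eq_prod]
  exact Measure.quasiMeasurePreserving_fst.ae (ae_restrict_of_ae h)

lemma ae_square_snd {q : ℝ → Prop} (h : ∀ᵐ v, q v) : ∀ᵐ p ∂squareMeasure, q p.2 := by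
  rw [squareMeasure_eq_prod]
  exact Measure.quasiMeasurePreserving_snd.ae (ae_restrict_of_ae h)

/-- The base case for the Fubini theorems: inside the square the half-lines (s,∞), (t,∞) coincide
with (s,1], (t,1]. -/
lemma hasStochIntegral_corner (hB : IsBivariateBrownianBridge B P) {s t : ℝ}
    (hs : s ∈ Set.Icc (0 : ℝ) 1) (ht : t ∈ Set.Icc (0 : ℝ) 1) :
    HasStochIntegral P B (fun p => stepInd s p.1 * stepInd t p.2) (corner B s t) := by
  refine (HasStochIntegral.of_rect hB (cornerRect hs ht)).congr ?_ (ae_of_all _ fun ω => ?_)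
  · filter_upwards [ae_mem_square] with p hp
    rw [Rect.ind_eq_mul]
    simp [stepInd, cornerRect, Set.indicator_apply, hp.1.2, hp.2.2]
  · rfl

/-- The Lebesgue measure of `{x ∈ [0,1] : g x < v}`. -/
def levelAvg (g : ℝ → ℝ) (v : ℝ) : ℝ := ∫ x in (0 : ℝ)..1, stepInd (g x) v

lemma intervalIntegrable_stepInd {g : ℝ → ℝ} (hg : Continuous g) (v a b : ℝ) :
    IntervalIntegrable (fun x => stepInd (g x) v) volume a b := by
  refine (intervalIntegrable_const (c := (1 : ℝ))).mono_fun ?_ (ae_of_all _ fun x => ?_)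
  · exact (measurable_stepInd.comp (hg.measurable.prodMk measurable_const)).aestronglyMeasurable
  · simp only [Real.norm_eq_abs, abs_one, abs_of_nonneg (stepInd_nonneg _ _)]
    exact stepInd_le_one _ _

lemma levelAvg_nonneg (g : ℝ → ℝ) (v : ℝ) : 0 ≤ levelAvg g v :=
  intervalIntegral.integral_nonneg zero_le_one fun _ _ => stepInd_nonneg _ _

lemma levelAvg_le_one {g : ℝ → ℝ} (hg : Continuous g) (v : ℝ) : levelAvg g v ≤ 1 := by
  have := intervalIntegral.integral_mono_on zero_le_one (intervalIntegrable_stepInd hg v 0 1)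
    (intervalIntegrable_const (c := (1 : ℝ))) fun x _ => stepInd_le_one (g x) v
  simpa [levelAvg] using this

/-- Paths of `corner B` along continuous curves are continuous. -/
lemma IsBivariateBrownianBridge.continuous_corner (hB : IsBivariateBrownianBridge B P) :
    ∀ᵐ ω ∂P, ContinuousOn (fun p : ℝ × ℝ => corner B p.1 p.2 ω)
      (Set.Icc 0 1 ×ˢ Set.Icc 0 1) := by
  filter_upwards [hB.continuous_paths] with ω hω
  have h1 : (1 : ℝ) ∈ Set.Icc (0 : ℝ) 1 := by simp
  have e1 : ContinuousOn (fun p : ℝ × ℝ => B p.1 1 ω) (Set.Icc 0 1 ×ˢ Set.Icc 0 1) :=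
    hω.comp (f := fun p : ℝ × ℝ => (p.1, (1 : ℝ))) (by fun_prop) fun p hp => ⟨hp.1, h1⟩
  have e2 : ContinuousOn (fun p : ℝ × ℝ => B 1 p.2 ω) (Set.Icc 0 1 ×ˢ Set.Icc 0 1) :=
    hω.comp (f := fun p : ℝ × ℝ => ((1 : ℝ), p.2)) (by fun_prop) fun p hp => ⟨h1, hp.2⟩
  exact ((continuousOn_const.sub e1).sub e2).add hω

/-- A stochastic Fubini theorem on the unit square. -/
lemma hasStochIntegral_levelAvg (hB : IsBivariateBrownianBridge B P) {g h : ℝ → ℝ}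
    (hg : Continuous g) (hh : Continuous h) (hg' : ∀ x, g x ∈ Set.Icc (0 : ℝ) 1)
    (hh' : ∀ x, h x ∈ Set.Icc (0 : ℝ) 1) :
    HasStochIntegral P B (fun p => levelAvg g p.1 * levelAvg h p.2)
      (fun ω => ∫ x in (0 : ℝ)..1, ∫ y in (0 : ℝ)..1, corner B (g x) (h y) ω) := by
  have hcont : ∀ᵐ ω ∂P, Continuous (Function.uncurry fun x y : ℝ => corner B (g x) (h y) ω) := by
    filter_upwards [hB.continuous_corner] with ω hω
    have := hω.comp_continuous (f := fun p : ℝ × ℝ => (g p.1, h p.2)) (by fun_prop)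
      fun p => ⟨hg' _, hh' _⟩
    exact this
  -- The average over y is taken with x frozen, then averaged over x; both integrands stay bounded
  -- by 1.
  have inner : ∀ x, HasStochIntegral P B (fun p => stepInd (g x) p.1 * levelAvg h p.2)
      (fun ω => ∫ y in (0 : ℝ)..1, corner B (g x) (h y) ω) := by
    intro x
    have := HasStochIntegral.average hB (M := 1)
      (f := fun y p => stepInd (g x) p.1 * stepInd (h y) p.2)
      (J := fun y => corner B (g x) (h y))
      (fun y _ => hasStochIntegral_corner hB (hg' x) (hh' y))
      (by
        filter_upwards [hcont] with ω hω
        exact hω.comp (by fun_prop : Continuous fun y : ℝ => (x, y)))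
      (fun y _ p => by
        rw [abs_of_nonneg (mul_nonneg (stepInd_nonneg _ _) (stepInd_nonneg _ _))]
        exact mul_le_one₀ (stepInd_le_one _ _) (stepInd_nonneg _ _) (stepInd_le_one _ _))
      (by
        filter_upwards [ae_square_snd (ae_ae_ne hh)] with p hp
        filter_upwards [hp] with y hy
        exact continuousAt_const.mul (continuousAt_stepInd hh hy))
    simpa only [intervalIntegral.integral_const_mul, levelAvg] using this
  have := HasStochIntegral.average hB (M := 1)
      (f := fun x p => stepInd (g x) p.1 * levelAvg h p.2)
      (J := fun x ω => ∫ y in (0 : ℝ)..1, corner B (g x) (h y) ω)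
      (fun x _ => inner x)
      (by
        filter_upwards [hcont] with ω hω
        exact intervalIntegral.continuous_parametric_intervalIntegral_of_continuous' hω _ _)
      (fun y _ p => by
        rw [abs_of_nonneg (mul_nonneg (stepInd_nonneg _ _) (levelAvg_nonneg _ _))]
        exact mul_le_one₀ (stepInd_le_one _ _) (levelAvg_nonneg _ _) (levelAvg_le_one hh _))
      (by
        filter_upwards [ae_square_fst (ae_ae_ne hg)] with p hp
        filter_upwards [hp] with y hy
        exact (continuousAt_stepInd hg hy).mul continuousAt_const)
  simpa only [intervalIntegral.integral_mul_const, levelAvg] using this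

/-! ### Absolute convergence and stochastic Fubini on the strip -/

/-- A process with almost surely continuous paths is jointly almost everywhere measurable. -/
lemma aemeasurable_uncurry_of_continuous {C : ℝ × ℝ → Ω → ℝ} {μ : Measure (ℝ × ℝ)} [SFinite μ]
    [SFinite P] (hC : ∀ p, AEMeasurable (C p) P) (hc : ∀ᵐ ω ∂P, Continuous fun p => C p ω) :
    AEMeasurable (Function.uncurry C) (μ.prod P) := by
  -- Replacing the parameter by simple approximations of the identity gives finite sums of jointly
  -- measurable products, which converge by path continuity.
  have h_str_meas : StronglyMeasurable (id : ℝ × ℝ → ℝ × ℝ) := stronglyMeasurable_id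
  refine aemeasurable_of_tendsto_metrizable_ae atTop
    (f := fun n (q : (ℝ × ℝ) × Ω) => C (h_str_meas.approx n q.1) q.2) (fun n => ?_) ?_
  · have e : (fun q : (ℝ × ℝ) × Ω => C (h_str_meas.approx n q.1) q.2) = fun q =>
        ∑ z ∈ (h_str_meas.approx n).range,
          ((h_str_meas.approx n) ⁻¹' {z}).indicator (1 : ℝ × ℝ → ℝ) q.1 * C z q.2 := by
      ext q
      rw [Finset.sum_eq_single (h_str_meas.approx n q.1)]
      · simp
      · intro z _ hz
        simp [hz.symm]
      · intro h
        exact absurd (SimpleFunc.mem_range_self _ _) h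
    rw [e]
    refine Finset.aemeasurable_fun_sum _ fun z _ => AEMeasurable.mul ?_ ?_
    · exact ((measurable_one.indicator
        ((h_str_meas.approx n).measurableSet_fiber z)).comp measurable_fst).aemeasurable
    · exact (hC z).comp_quasiMeasurePreserving Measure.quasiMeasurePreserving_snd
  · filter_upwards [Measure.quasiMeasurePreserving_snd.ae hc] with q hq
    exact (hq.tendsto _).comp (h_str_meas.tendsto_approx q.1)

lemma IsBivariateBrownianBridge.memLp_corner (hB : IsBivariateBrownianBridge B P) {s t : ℝ}
    (hs : s ∈ Set.Icc (0 : ℝ) 1) (ht : t ∈ Set.Icc (0 : ℝ) 1) : MemLp (corner B s t) 2 P :=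
  hB.memLp_mass (cornerRect hs ht)

/-- The variance is A - A² with A = (1-s)(1-t). Only the factor 1-t is kept, as it supplies the
decay along the strip. -/
lemma IsBivariateBrownianBridge.integral_corner_sq_le (hB : IsBivariateBrownianBridge B P)
    {s t : ℝ} (hs : s ∈ Set.Icc (0 : ℝ) 1) (ht : t ∈ Set.Icc (0 : ℝ) 1) :
    ∫ ω, corner B s t ω * corner B s t ω ∂P ≤ 1 - t := by
  have h := hB.integral_mass_mul_mass (cornerRect hs ht) (cornerRect hs ht)
  rw [Rect.integral_ind_mul, Rect.integral_ind] at h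
  simp only [cornerRect, min_self, min_eq_left hs.2, min_eq_right hs.2, min_eq_left ht.2,
    min_eq_right ht.2] at h
  refine (le_of_eq (show _ = _ from h)).trans ?_
  nlinarith [mul_nonneg hs.1 (sub_nonneg.2 ht.2), sq_nonneg ((1 - s) * (1 - t))]

/-- From |c| ≤ a c² + 1/a. The weight `a` is free so that it can grow with the height in the strip.
-/
lemma IsBivariateBrownianBridge.integral_abs_corner_le (hB : IsBivariateBrownianBridge B P)
    {s t a : ℝ} (hs : s ∈ Set.Icc (0 : ℝ) 1) (ht : t ∈ Set.Icc (0 : ℝ) 1) (ha : 0 < a) :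
    ∫ ω, |corner B s t ω| ∂P ≤ a * (1 - t) + a⁻¹ := by
  have hP := hB.gaussian.isProbabilityMeasure
  have hm := hB.memLp_corner hs ht
  have h2 : Integrable (fun ω => corner B s t ω * corner B s t ω) P := hm.integrable_mul hm
  calc ∫ ω, |corner B s t ω| ∂P
      ≤ ∫ ω, (a * (corner B s t ω * corner B s t ω) + a⁻¹) ∂P := by
        refine integral_mono (hm.integrable one_le_two).abs
          ((h2.const_mul a).add (integrable_const _)) fun ω => ?_
        have h3 : a * a⁻¹ = 1 := mul_inv_cancel₀ ha.ne'
        simp only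
        rw [← abs_mul_abs_self (corner B s t ω)]
        have h4 : 0 ≤ a * (|corner B s t ω| - a⁻¹) ^ 2 := by positivity
        have h5 : a * (|corner B s t ω| - a⁻¹) ^ 2 = a * (|corner B s t ω| * |corner B s t ω|)
          - 2 * (a * a⁻¹) * |corner B s t ω| + (a * a⁻¹) * a⁻¹ := by ring
        rw [h5, h3] at h4
        linarith [abs_nonneg (corner B s t ω)]
    _ = a * ∫ ω, corner B s t ω * corner B s t ω ∂P + a⁻¹ := by
        rw [integral_add (h2.const_mul a) (integrable_const _), integral_const_mul]
        simp
    _ ≤ a * (1 - t) + a⁻¹ := by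
        gcongr; exact hB.integral_corner_sq_le hs ht

/-- Absolute convergence of the integrated corner masses. -/
lemma IsBivariateBrownianBridge.integrableOn_corner (hB : IsBivariateBrownianBridge B P)
    {g h : ℝ → ℝ} {K : ℝ}
    (hg : Continuous g) (hh : Continuous h) (hg' : ∀ x, g x ∈ Set.Icc (0 : ℝ) 1)
    (hh' : ∀ x, h x ∈ Set.Icc (0 : ℝ) 1)
    (hK : ∀ y, 0 ≤ y → 1 - h y ≤ K * Real.exp (-(1 / 2) * y)) :
    ∀ᵐ ω ∂P, IntegrableOn (fun p : ℝ × ℝ => corner B (g p.1) (h p.2) ω)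
      (Set.Icc 0 1 ×ˢ Set.Ici 0) := by
  have hP := hB.gaussian.isProbabilityMeasure
  set μ : Measure (ℝ × ℝ) := volume.restrict (Set.Icc 0 1 ×ˢ Set.Ici 0) with hμ
  set C : ℝ × ℝ → Ω → ℝ := fun p => corner B (g p.1) (h p.2) with hC
  have hm : AEMeasurable (Function.uncurry C) (μ.prod P) := by
    refine aemeasurable_uncurry_of_continuous
      (fun p => (hB.memLp_corner (hg' _) (hh' _)).aestronglyMeasurable.aemeasurable) ?_
    filter_upwards [hB.continuous_corner] with ω hω
    exact hω.comp_continuous (f := fun p : ℝ × ℝ => (g p.1, h p.2)) (by fun_prop)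
      fun p => ⟨hg' _, hh' _⟩
  have hint : Integrable (Function.uncurry C) (μ.prod P) := by
    rw [integrable_prod_iff hm.aestronglyMeasurable]
    refine ⟨ae_of_all _ fun p =>
      show Integrable (corner B (g p.1) (h p.2)) P from
        (hB.memLp_corner (hg' _) (hh' _)).integrable one_le_two, ?_⟩
    have hb : Integrable (fun p : ℝ × ℝ => (1 : ℝ) * ((K + 1) * Real.exp (-(1 / 4) * p.2))) μ := by
      have : μ = (volume.restrict (Set.Icc (0 : ℝ) 1)).prod (volume.restrict (Set.Ici (0 : ℝ))) := by
        rw [Measure.prod_restrict]; rfl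
      rw [this]
      refine Integrable.mul_prod (f := fun _ : ℝ => (1 : ℝ))
        (g := fun y : ℝ => (K + 1) * Real.exp (-(1 / 4) * y)) (integrable_const _) ?_
      refine Integrable.const_mul ?_ _
      have := exp_neg_integrableOn_Ioi 0 (by norm_num : (0 : ℝ) < 1 / 4)
      exact (integrableOn_Ici_iff_integrableOn_Ioi (by simp)).2 this
    refine hb.mono' (hm.aestronglyMeasurable.norm.integral_prod_right') ?_
    filter_upwards [ae_restrict_mem (measurableSet_Icc.prod measurableSet_Ici)] with p hp
    rw [Real.norm_of_nonneg (integral_nonneg fun _ => norm_nonneg _)]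
    -- With weight exp(y/4) against the tail K exp(-y/2), both terms of the bound are multiples of
    -- exp(-y/4).
    have h1 := hB.integral_abs_corner_le (hg' p.1) (hh' p.2) (Real.exp_pos (1 / 4 * p.2))
    have h2 := hK p.2 hp.2
    refine (show _ ≤ _ from h1).trans ?_
    have h3 : Real.exp (1 / 4 * p.2) * (1 - h p.2) ≤
        Real.exp (1 / 4 * p.2) * (K * Real.exp (-(1 / 2) * p.2)) := by gcongr
    have h4 : Real.exp (1 / 4 * p.2) * (K * Real.exp (-(1 / 2) * p.2)) =
        K * Real.exp (-(1 / 4) * p.2) := by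
      rw [mul_left_comm, ← Real.exp_add]; congr 2; ring
    have h5 : (Real.exp (1 / 4 * p.2))⁻¹ = Real.exp (-(1 / 4) * p.2) := by
      rw [← Real.exp_neg]; congr 1; ring
    rw [h5]
    linarith
  exact hint.prod_left_ae

/-- A stochastic Fubini theorem on the strip `[0,1] × [0,∞)`. -/
lemma hasStochIntegral_strip (hB : IsBivariateBrownianBridge B P)
    {g h q : ℝ → ℝ} {K : ℝ}
    (hg : Continuous g) (hh : Continuous h) (hg' : ∀ x, g x ∈ Set.Icc (0 : ℝ) 1)
    (hh' : ∀ x, h x ∈ Set.Icc (0 : ℝ) 1)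
    (hK : ∀ y, 0 ≤ y → 1 - h y ≤ K * Real.exp (-(1 / 2) * y))
    (hq0 : ∀ v, 0 ≤ q v) (hq2 : MemLp (fun p : ℝ × ℝ => q p.2) 2 squareMeasure)
    (hq : ∀ᵐ p ∂squareMeasure, ∀ n : ℕ, ∫ y in (0 : ℝ)..n, stepInd (h y) p.2 = min (q p.2) n) :
    HasStochIntegral P B (fun p => levelAvg g p.1 * q p.2)
      (fun ω => ∫ p in Set.Icc (0 : ℝ) 1 ×ˢ Set.Ici (0 : ℝ), corner B (g p.1) (h p.2) ω) := by
  -- The strip is truncated at height n, and rescaling y by n carries [0,n] back to the unit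
  -- interval.
  have hn : ∀ n : ℕ, HasStochIntegral P B (fun p => levelAvg g p.1 * min (q p.2) n)
      (fun ω => ∫ x in (0 : ℝ)..1, ∫ y in (0 : ℝ)..n, corner B (g x) (h y) ω) := by
    intro n
    refine (HasStochIntegral.const_mul (n : ℝ) (hasStochIntegral_levelAvg hB hg
      (hh.comp (continuous_const_mul (n : ℝ))) hg' (fun x => hh' _))).congr ?_
      (ae_of_all _ fun ω => ?_)
    · filter_upwards [hq] with p hp
      rw [← hp n, mul_left_comm]
      congr 1
      have := intervalIntegral.mul_integral_comp_mul_left (a := 0) (b := 1)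
        (f := fun y => stepInd (h y) p.2) (n : ℝ)
      simpa [levelAvg] using this
    · simp only
      rw [← intervalIntegral.integral_const_mul]
      congr 1; ext x
      have := intervalIntegral.mul_integral_comp_mul_left (a := 0) (b := 1)
        (f := fun y => corner B (g x) (h y) ω) (n : ℝ)
      simpa using this
  have hL := tendsto_eLpNorm_two_of_dominated (μ := squareMeasure) (bound := fun p => q p.2)
    (f := fun p => levelAvg g p.1 * q p.2) (fun n => (hn n).1.aestronglyMeasurable) hq2
    (fun n => ae_of_all _ fun p => by
      have h1 : 0 ≤ min (q p.2) (n : ℝ) := le_min (hq0 _) (Nat.cast_nonneg _)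
      rw [abs_of_nonneg (mul_nonneg (levelAvg_nonneg _ _) h1)]
      calc _ ≤ 1 * min (q p.2) (n : ℝ) := by gcongr; exact levelAvg_le_one hg _
        _ ≤ q p.2 := by rw [one_mul]; exact min_le_left _ _)
    (ae_of_all _ fun p => by
      refine tendsto_const_nhds.mul (tendsto_const_nhds.congr' ?_)
      filter_upwards [eventually_ge_atTop ⌈q p.2⌉₊] with n hn
      rw [min_eq_left (Nat.ceil_le.1 hn)])
  refine HasStochIntegral.of_tendsto hB hn hL.1 hL.2 ?_
  filter_upwards [hB.integrableOn_corner hg hh hg' hh' hK] with ω hω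
  have hunion : (⋃ n : ℕ, Set.Icc (0 : ℝ) 1 ×ˢ Set.Icc (0 : ℝ) n) =
      Set.Icc (0 : ℝ) 1 ×ˢ Set.Ici (0 : ℝ) := by
    ext p
    simp only [Set.mem_iUnion, Set.mem_prod, Set.mem_Icc, Set.mem_Ici]
    refine ⟨fun ⟨n, h1, h2⟩ => ⟨h1, h2.1⟩, fun h1 => ?_⟩
    obtain ⟨n, hn⟩ := exists_nat_ge p.2
    exact ⟨n, h1.1, h1.2, hn⟩
  have ht := tendsto_setIntegral_of_monotone (μ := volume)
    (s := fun n : ℕ => Set.Icc (0 : ℝ) 1 ×ˢ Set.Icc (0 : ℝ) n)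
    (f := fun p : ℝ × ℝ => corner B (g p.1) (h p.2) ω)
    (fun n => measurableSet_Icc.prod measurableSet_Icc)
    (fun m n hmn => Set.prod_mono le_rfl (Set.Icc_subset_Icc_right (by exact_mod_cast hmn)))
    (by rw [hunion]; exact hω)
  rw [hunion] at ht
  refine ht.congr fun n => ?_
  rw [Measure.volume_eq_prod, setIntegral_prod, intervalIntegral.integral_of_le zero_le_one,
    integral_Icc_eq_integral_Ioc]
  · congr 1; ext x
    rw [intervalIntegral.integral_of_le (Nat.cast_nonneg n), integral_Icc_eq_integral_Ioc]
  · rw [← Measure.volume_eq_prod]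
    exact hω.mono_set (Set.prod_mono le_rfl Set.Icc_subset_Ici_self)

/-! ### Boundary values of the bridge -/

lemma IsBivariateBrownianBridge.ae_eq_zero (hB : IsBivariateBrownianBridge B P) {u v : ℝ}
    (hu : u ∈ Set.Icc (0 : ℝ) 1) (hv : v ∈ Set.Icc (0 : ℝ) 1)
    (h : u * v - u * u * v * v = 0) : ∀ᵐ ω ∂P, B u v ω = 0 := by
  have h1 := hB.covariance u hu v hv u hu v hv
  rw [min_self, min_self, h, integral_eq_zero_iff_of_nonneg (fun ω => mul_self_nonneg _)
    ((hB.memLp hu hv).integrable_mul (hB.memLp hu hv))] at h1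
  filter_upwards [h1] with ω hω
  exact mul_self_eq_zero.1 hω

/-- Vanishing is known almost surely at each fixed point; a countable dense set and continuity give
one null set for all points at once. -/
lemma eqOn_zero_of_dense {φ : ℝ → ℝ} (hφ : ContinuousOn φ (Set.Icc 0 1))
    (h : ∀ n, φ (TopologicalSpace.denseSeq (Set.Icc (0 : ℝ) 1) n) = 0) :
    ∀ v ∈ Set.Icc (0 : ℝ) 1, φ v = 0 := by
  have hc := continuousOn_iff_continuous_domRestrict.1 hφ
  have := hc.ext_on (TopologicalSpace.denseRange_denseSeq (Set.Icc (0 : ℝ) 1))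
    (continuous_const (y := (0 : ℝ))) (by rintro _ ⟨n, rfl⟩; exact h n)
  exact fun v hv => congrFun this ⟨v, hv⟩

/-- The bridge vanishes on the lower-left boundary and at the upper-right corner. -/
lemma IsBivariateBrownianBridge.boundary (hB : IsBivariateBrownianBridge B P) :
    ∀ᵐ ω ∂P, B 1 1 ω = 0 ∧ ∀ v ∈ Set.Icc (0 : ℝ) 1, B 0 v ω = 0 ∧ B v 0 ω = 0 := by
  have h0 : (0 : ℝ) ∈ Set.Icc (0 : ℝ) 1 := by simp
  have h1 : (1 : ℝ) ∈ Set.Icc (0 : ℝ) 1 := by simp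
  let d := TopologicalSpace.denseSeq (Set.Icc (0 : ℝ) 1)
  have e1 : ∀ᵐ ω ∂P, ∀ n, B 0 (d n) ω = 0 :=
    ae_all_iff.2 fun n => hB.ae_eq_zero h0 (d n).2 (by ring)
  have e2 : ∀ᵐ ω ∂P, ∀ n, B (d n) 0 ω = 0 :=
    ae_all_iff.2 fun n => hB.ae_eq_zero (d n).2 h0 (by ring)
  filter_upwards [hB.ae_eq_zero h1 h1 (by ring), e1, e2, hB.continuous_paths] with ω a1 a2 a3 hω
  refine ⟨a1, fun v hv => ⟨?_, ?_⟩⟩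
  · exact eqOn_zero_of_dense (φ := fun v => B 0 v ω)
      (hω.comp (f := fun v : ℝ => ((0 : ℝ), v)) (by fun_prop) fun p hp => ⟨h0, hp⟩) a2 v hv
  · exact eqOn_zero_of_dense (φ := fun v => B v 0 ω)
      (hω.comp (f := fun v : ℝ => (v, (0 : ℝ))) (by fun_prop) fun p hp => ⟨hp, h0⟩) a3 v hv

end Wiener

/-! ### Quantile functions of laws with a density -/

/-- `G` is a continuous distribution function with positive density `g` on the interval `D`, which
starts at `0`, and `Q` is its quantile function. -/
structure IsRegularQuantile (D : Set ℝ) (G g Q : ℝ → ℝ) : Prop where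
  isOpen : IsOpen D
  pos : ∀ x ∈ D, 0 < x
  lower : ∀ x ∈ D, Set.Ioo 0 x ⊆ D
  continuous : Continuous G
  mem_Icc : ∀ x, G x ∈ Set.Icc (0 : ℝ) 1
  mono : Monotone G
  lt : ∀ x ∈ D, ∀ y < x, G y < G x
  hasDerivAt : ∀ x ∈ D, HasDerivAt G (g x) x
  density_pos : ∀ x ∈ D, 0 < g x
  image : G '' D = Set.Ioo 0 1
  quantile : ∀ v, Q v = sInf {x | 0 ≤ x ∧ v ≤ G x}

/-- Distribution functions given by a density. -/
lemma isRegularQuantile_of_density {D : Set ℝ} {g Q : ℝ → ℝ} {μ : Measure ℝ}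
    [IsProbabilityMeasure μ] (hμ : μ = volume.withDensity fun x => ENNReal.ofReal (g x))
    (hD : IsOpen D) (hpos : ∀ x ∈ D, 0 < x) (hlow : ∀ x ∈ D, Set.Ioo 0 x ⊆ D) (hg : Measurable g)
    (hg0 : ∀ x ∉ D, x ≠ 0 → g x = 0) (hgpos : ∀ x ∈ D, 0 < g x)
    (hgc : ∀ x ∈ D, ContinuousAt g x) (hQ : ∀ v, Q v = sInf {x | 0 ≤ x ∧ v ≤ cdf μ x}) :
    IsRegularQuantile D (cdf μ) g Q := by
  have hgnn : 0 ≤ᵐ[volume] g := by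
    filter_upwards [Measure.ae_ne volume (0 : ℝ)] with x hx
    by_cases h : x ∈ D
    · exact (hgpos x h).le
    · exact (hg0 x h hx).ge
  have hint : Integrable g := by
    refine ⟨hg.aestronglyMeasurable, ?_⟩
    rw [hasFiniteIntegral_iff_ofReal hgnn, ← setLIntegral_univ,
      ← withDensity_apply _ MeasurableSet.univ, ← hμ]
    exact measure_lt_top _ _
  have hreal : ∀ s, MeasurableSet s → μ.real s = ∫ x in s, g x := by
    intro s hs
    rw [measureReal_def, hμ, withDensity_apply _ hs,
      integral_eq_lintegral_of_nonneg_ae (ae_restrict_of_ae hgnn) hg.aestronglyMeasurable]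
  have hcdf : ∀ x, cdf μ x = ∫ x in Set.Iic x, g x := fun x => by
    rw [cdf_eq_real, hreal _ measurableSet_Iic]
  have hsub : ∀ a b, cdf μ b - cdf μ a = ∫ x in a..b, g x := fun a b => by
    rw [hcdf, hcdf, intervalIntegral.integral_Iic_sub_Iic hint.integrableOn hint.integrableOn]
  have hprim : (cdf μ : ℝ → ℝ) = fun x => cdf μ 0 + ∫ x in (0 : ℝ)..x, g x := by
    ext x; rw [← hsub]; ring
  have hcont : Continuous (cdf μ) := by
    rw [hprim]
    exact continuous_const.add
      (intervalIntegral.continuous_primitive (fun a b => hint.intervalIntegrable) 0)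
  have hmem : ∀ x, cdf μ x ∈ Set.Icc (0 : ℝ) 1 := fun x => ⟨cdf_nonneg _ _, cdf_le_one _ _⟩
  have hlt : ∀ x ∈ D, ∀ y < x, cdf μ y < cdf μ x := by
    intro x hx y hy
    have hx0 := hpos x hx
    -- The point y may lie outside `D`, where positivity of the density fails; starting at max(y,
    -- x/2) keeps the integral inside (0,x) ⊆ `D`.
    have hz : max y (x / 2) < x := max_lt hy (by linarith)
    have h1 : 0 < ∫ t in max y (x / 2)..x, g t :=
      intervalIntegral.intervalIntegral_pos_of_pos_on hint.intervalIntegrable (fun t ht =>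
        hgpos t (hlow x hx ⟨lt_of_lt_of_le (by linarith) ((le_max_right _ _).trans ht.1.le),
          ht.2⟩)) hz
    rw [← hsub] at h1
    linarith [monotone_cdf μ (le_max_left y (x / 2))]
  -- `D` is an initial piece of the positive axis, so off `D` no mass lies to the left of x or none
  -- to its right. A preimage of a value in (0,1) must then lie in `D`.
  have hout : ∀ x ∉ D, cdf μ x = 0 ∨ cdf μ x = 1 := by
    intro x hx
    rcases le_or_gt x 0 with h | h
    · left
      rw [hcdf]
      refine integral_eq_zero_of_ae ?_
      filter_upwards [ae_restrict_mem measurableSet_Iic,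
        ae_restrict_of_ae (Measure.ae_ne volume (0 : ℝ))] with y hy hy0
      exact hg0 y (fun hyD => absurd (hpos y hyD) (not_lt.2 ((Set.mem_Iic.1 hy).trans h))) hy0
    · right
      have h1 : μ.real (Set.Ioi x) = 0 := by
        rw [hreal _ measurableSet_Ioi]
        refine integral_eq_zero_of_ae ?_
        filter_upwards [ae_restrict_mem measurableSet_Ioi] with y hy
        exact hg0 y (fun hyD => hx (hlow y hyD ⟨h, hy⟩)) (h.trans hy).ne'
      have h2 := probReal_compl_eq_one_sub (μ := μ) (measurableSet_Iic (a := x))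
      rw [Set.compl_Iic, h1, ← cdf_eq_real] at h2
      linarith
  refine ⟨hD, hpos, hlow, hcont, hmem, monotone_cdf μ, hlt, fun x hx => ?_, hgpos, ?_, hQ⟩
  · rw [hprim]
    exact (intervalIntegral.integral_hasDerivAt_right hint.intervalIntegrable
      (hg.stronglyMeasurable.stronglyMeasurableAtFilter) (hgc x hx)).const_add _
  · refine Set.Subset.antisymm ?_ fun v hv => ?_
    · rintro _ ⟨x, hx, rfl⟩
      refine ⟨lt_of_le_of_lt (cdf_nonneg μ (x - 1)) (hlt x hx _ (by linarith)), ?_⟩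
      obtain ⟨z, hz, hzx⟩ : ∃ z ∈ D, x < z := by
        have h1 : D ∈ 𝓝[>] x := mem_nhdsWithin_of_mem_nhds (hD.mem_nhds hx)
        obtain ⟨z, hz⟩ := (nonempty_of_mem (inter_mem h1 self_mem_nhdsWithin))
        exact ⟨z, hz.1, hz.2⟩
      exact lt_of_lt_of_le (hlt z hz x hzx) (cdf_le_one _ _)
    · obtain ⟨a, ha⟩ := ((tendsto_cdf_atBot μ).eventually (ge_mem_nhds hv.1)).exists
      obtain ⟨b, hb⟩ := ((tendsto_cdf_atTop μ).eventually (le_mem_nhds hv.2)).exists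
      obtain ⟨x, hx⟩ := mem_range_of_exists_le_of_exists_ge hcont ⟨a, ha⟩ ⟨b, hb⟩
      refine ⟨x, ?_, hx⟩
      by_contra hxD
      rcases hout x hxD with h | h
      · exact hv.1.ne (h.symm.trans hx)
      · exact hv.2.ne (hx.symm.trans h)

namespace IsRegularQuantile

variable {D : Set ℝ} {G g Q : ℝ → ℝ}

lemma le_iff (h : IsRegularQuantile D G g Q) {x y : ℝ} (hx : x ∈ D) : G x ≤ G y ↔ x ≤ y :=
  ⟨fun hxy => le_of_not_gt fun hlt => absurd (h.lt x hx y hlt) (not_lt.2 hxy), fun hxy => h.mono hxy⟩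

lemma quantile_apply (h : IsRegularQuantile D G g Q) {x : ℝ} (hx : x ∈ D) : Q (G x) = x := by
  have : {y | 0 ≤ y ∧ G x ≤ G y} = Set.Ici x := by
    ext y
    simp only [Set.mem_ofPred_eq, h.le_iff hx, Set.mem_Ici]
    exact ⟨fun hy => hy.2, fun hy => ⟨(h.pos x hx).le.trans hy, hy⟩⟩
  rw [h.quantile, this, csInf_Ici]

lemma exists_eq (h : IsRegularQuantile D G g Q) {v : ℝ} (hv : v ∈ Set.Ioo (0 : ℝ) 1) : ∃ x ∈ D, G x = v := by
  rw [← h.image] at hv; exact hv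

lemma quantile_mem (h : IsRegularQuantile D G g Q) {v : ℝ} (hv : v ∈ Set.Ioo (0 : ℝ) 1) : Q v ∈ D := by
  obtain ⟨x, hx, rfl⟩ := h.exists_eq hv
  rwa [h.quantile_apply hx]

/-- The source of the layer-cake formula: `stepInd (G y) v` is the indicator of y < Q(v). -/
lemma lt_quantile_iff (h : IsRegularQuantile D G g Q) {v y : ℝ} (hv : v ∈ Set.Ioo (0 : ℝ) 1) : G y < v ↔ y < Q v := by
  obtain ⟨x, hx, rfl⟩ := h.exists_eq hv
  rw [h.quantile_apply hx, ← not_le, ← not_le, h.le_iff hx]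

lemma quantile_nonneg (h : IsRegularQuantile D G g Q) (v : ℝ) : 0 ≤ Q v := by
  rw [h.quantile]
  exact Real.sInf_nonneg fun x hx => hx.1

lemma monotoneOn_quantile (h : IsRegularQuantile D G g Q) : MonotoneOn Q (Set.Ioo 0 1) := by
  intro v hv w hw hvw
  by_contra hlt
  have h1 := (h.lt_quantile_iff hv).2 (not_le.1 hlt)
  have h2 := (h.lt_quantile_iff (y := Q w) hw).not.2 (lt_irrefl _)
  exact h2 (h1.trans_le hvw)

lemma aemeasurable_quantile (h : IsRegularQuantile D G g Q) : AEMeasurable Q (volume.restrict (Set.Icc (0 : ℝ) 1)) := by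
  rw [← restrict_Ioo_eq_restrict_Icc]
  exact aemeasurable_restrict_of_monotoneOn measurableSet_Ioo h.monotoneOn_quantile

/-- The inverse function rule. Continuity of `Q`, which the rule needs, follows from strict
monotonicity and the open image `D`. -/
lemma hasDerivAt_quantile (h : IsRegularQuantile D G g Q) {x : ℝ} (hx : x ∈ D) : HasDerivAt Q (g x)⁻¹ (G x) := by
  have hGx : G x ∈ Set.Ioo (0 : ℝ) 1 := h.image ▸ Set.mem_image_of_mem G hx
  have himg : Q '' Set.Ioo 0 1 = D := by
    rw [← h.image, Set.image_image]
    exact (Set.image_congr fun y hy => h.quantile_apply hy).trans (Set.image_id' D)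
  have hsm : StrictMonoOn Q (Set.Ioo 0 1) := by
    intro v hv w hw hvw
    obtain ⟨y, hy, rfl⟩ := h.exists_eq hv
    rw [h.quantile_apply hy]
    exact (h.lt_quantile_iff hw).1 hvw
  have hc : ContinuousAt Q (G x) := by
    refine hsm.continuousAt_of_image_mem_nhds (isOpen_Ioo.mem_nhds hGx) ?_
    rw [himg, h.quantile_apply hx]
    exact h.isOpen.mem_nhds hx
  refine HasDerivAt.of_local_left_inverse (f := G) hc ?_ (h.density_pos x hx).ne' ?_
  · rw [h.quantile_apply hx]; exact h.hasDerivAt x hx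
  · filter_upwards [isOpen_Ioo.mem_nhds hGx] with v hv
    obtain ⟨y, hy, rfl⟩ := h.exists_eq hv
    rw [h.quantile_apply hy]

lemma injOn (h : IsRegularQuantile D G g Q) : Set.InjOn G D := by
  intro x hx y hy hxy
  rw [← h.quantile_apply hx, hxy, h.quantile_apply hy]

lemma measurableSet (h : IsRegularQuantile D G g Q) : MeasurableSet D := h.isOpen.measurableSet

lemma integral_stepInd (h : IsRegularQuantile D G g Q) {v T : ℝ} (hv : v ∈ Set.Ioo (0 : ℝ) 1) (hT : 0 ≤ T) :
    ∫ y in (0 : ℝ)..T, stepInd (G y) v = min (Q v) T := by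
  have e : ∀ y, stepInd (G y) v = (Set.Iio (Q v)).indicator 1 y := by
    intro y
    classical
    simp only [stepInd, Set.indicator_apply, Set.mem_Ioi, Set.mem_Iio, h.lt_quantile_iff hv,
      Pi.one_apply]
  simp_rw [e]
  have hQ := (h.pos _ (h.quantile_mem hv)).le
  rw [intervalIntegral.integral_of_le hT, integral_indicator_one measurableSet_Iio,
    measureReal_restrict_apply measurableSet_Iio, measureReal_congr
      (show (Set.Iio (Q v) ∩ Set.Ioc 0 T : Set ℝ) =ᵐ[volume] Set.Ioc 0 (min (Q v) T) from ?_),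
    measureReal_def, Real.volume_Ioc, sub_zero, ENNReal.toReal_ofReal (le_min hQ hT)]
  have h2 : Set.Ioc 0 (min (Q v) T) = Set.Iic (Q v) ∩ Set.Ioc 0 T := by
    ext y; simp only [Set.mem_Ioc, le_min_iff, Set.mem_inter_iff, Set.mem_Iic]; tauto
  rw [h2]
  exact Iio_ae_eq_Iic.inter (ae_eq_refl _)

/-- The image of Lebesgue measure on `D` under `1 - G`. -/
lemma map_one_sub (h : IsRegularQuantile D G g Q) : (volume.restrict D).map (fun x => 1 - G x) =
    (volume.restrict (Set.Icc (0 : ℝ) 1)).withDensity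
      fun v => ENNReal.ofReal (deriv Q (1 - v)) := by
  have himg : (fun x => 1 - G x) '' D = Set.Ioo 0 1 := by
    have : (fun x => 1 - G x) '' D = (fun v => 1 - v) '' (G '' D) := by rw [Set.image_image]
    rw [this, h.image]
    simp
  rw [← restrict_Ioo_eq_restrict_Icc]
  ext s hs
  have hm : Measurable fun x => 1 - G x := by have := h.continuous.measurable; fun_prop
  rw [Measure.map_apply hm hs, withDensity_apply _ hs, ← lintegral_indicator_one (hm hs),
    ← lintegral_indicator hs, ← himg, lintegral_image_eq_lintegral_abs_deriv_mul h.measurableSet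
      (fun x hx => ((h.hasDerivAt x hx).const_sub 1).hasDerivWithinAt)
      (fun x hx y hy hxy => h.injOn hx hy (by simpa using hxy))]
  refine setLIntegral_congr_fun h.measurableSet fun x hx => ?_
  have hp := h.density_pos x hx
  classical
  simp only [Set.indicator_apply, Set.mem_preimage, Pi.one_apply, abs_neg, abs_of_pos hp,
    sub_sub_cancel, (h.hasDerivAt_quantile hx).deriv]
  split_ifs
  · rw [← ENNReal.ofReal_mul hp.le, mul_inv_cancel₀ hp.ne', ENNReal.ofReal_one]
  · rw [mul_zero]

lemma deriv_quantile_nonneg (h : IsRegularQuantile D G g Q) :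
    ∀ᵐ v ∂(volume.restrict (Set.Icc (0 : ℝ) 1)), 0 ≤ deriv Q (1 - v) := by
  rw [← restrict_Ioo_eq_restrict_Icc]
  filter_upwards [ae_restrict_mem measurableSet_Ioo] with v hv
  obtain ⟨x, hx, hxv⟩ := h.exists_eq (v := 1 - v) ⟨by linarith [hv.2], by linarith [hv.1]⟩
  rw [← hxv, (h.hasDerivAt_quantile hx).deriv]
  exact (inv_pos.2 (h.density_pos x hx)).le

lemma integral_comp_quantile (h : IsRegularQuantile D G g Q) (φ : ℝ → ℝ) :
    ∫ v in Set.Icc (0 : ℝ) 1, φ (Q v) = ∫ x in D, g x * φ x := by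
  rw [integral_Icc_eq_integral_Ioo, ← h.image,
    integral_image_eq_integral_abs_deriv_smul h.measurableSet
      (fun x hx => (h.hasDerivAt x hx).hasDerivWithinAt) h.injOn]
  refine setIntegral_congr_fun h.measurableSet fun x hx => ?_
  simp only [abs_of_pos (h.density_pos x hx), h.quantile_apply hx, smul_eq_mul]

lemma integrable_comp_quantile (h : IsRegularQuantile D G g Q) {φ : ℝ → ℝ} (hφ : IntegrableOn (fun x => g x * φ x) D) :
    IntegrableOn (fun v => φ (Q v)) (Set.Icc (0 : ℝ) 1) := by
  rw [integrableOn_Icc_iff_integrableOn_Ioo, ← h.image,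
    integrableOn_image_iff_integrableOn_abs_deriv_smul h.measurableSet
      (fun x hx => (h.hasDerivAt x hx).hasDerivWithinAt) h.injOn]
  refine hφ.congr_fun (fun x hx => ?_) h.measurableSet
  simp only [abs_of_pos (h.density_pos x hx), h.quantile_apply hx, smul_eq_mul]

/-- The mean as the integral of the tail. -/
lemma integral_one_sub (h : IsRegularQuantile D G g Q) : ∫ x in D, (1 - G x) = ∫ v in Set.Icc (0 : ℝ) 1, Q v := by
  have hQm := h.aemeasurable_quantile
  rw [integral_Icc_eq_integral_Ioo, integral_eq_lintegral_of_nonneg_ae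
    (ae_of_all _ fun x => sub_nonneg.2 (h.mem_Icc x).2)
    (by have := h.continuous; exact (by fun_prop : Continuous fun x => 1 - G x).aestronglyMeasurable),
    integral_eq_lintegral_of_nonneg_ae (ae_of_all _ h.quantile_nonneg)
    (by rw [restrict_Ioo_eq_restrict_Icc]; exact hQm.aestronglyMeasurable)]
  -- Both sides measure the region {(x,v) : x ∈ D, 0 < v < 1, G(x) < v}, sliced along one axis or
  -- the other.
  congr 1
  have hm : Measurable (Function.uncurry fun x v : ℝ => ENNReal.ofReal (stepInd (G x) v)) :=
    (measurable_stepInd.comp ((h.continuous.measurable.comp measurable_fst).prodMk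
      measurable_snd)).ennreal_ofReal
  have e1 : ∀ x, ENNReal.ofReal (1 - G x) =
      ∫⁻ v in Set.Ioo (0 : ℝ) 1, ENNReal.ofReal (stepInd (G x) v) := by
    intro x
    have : ∀ v, ENNReal.ofReal (stepInd (G x) v) = (Set.Ioi (G x)).indicator 1 v := by
      intro v
      simp only [stepInd, Set.indicator_apply]
      split_ifs <;> simp
    simp_rw [this]
    rw [lintegral_indicator_one measurableSet_Ioi, Measure.restrict_apply measurableSet_Ioi]
    have h2 : Set.Ioi (G x) ∩ Set.Ioo 0 1 = Set.Ioo (G x) 1 := by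
      ext v
      simp only [Set.mem_inter_iff, Set.mem_Ioi, Set.mem_Ioo]
      exact ⟨fun hv => ⟨hv.1, hv.2.2⟩, fun hv => ⟨hv.1, (h.mem_Icc x).1.trans_lt hv.1, hv.2⟩⟩
    rw [h2, Real.volume_Ioo]
  have e2 : ∀ v ∈ Set.Ioo (0 : ℝ) 1, ∫⁻ x in D, ENNReal.ofReal (stepInd (G x) v) =
      ENNReal.ofReal (Q v) := by
    intro v hv
    have : ∀ x, ENNReal.ofReal (stepInd (G x) v) = (Set.Iio (Q v)).indicator 1 x := by
      intro x
      simp only [stepInd, Set.indicator_apply, Set.mem_Ioi, Set.mem_Iio, h.lt_quantile_iff hv]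
      split_ifs <;> simp
    simp_rw [this]
    rw [lintegral_indicator_one measurableSet_Iio, Measure.restrict_apply measurableSet_Iio]
    have h2 : Set.Iio (Q v) ∩ D = Set.Ioo 0 (Q v) := by
      ext x
      exact ⟨fun hx => ⟨h.pos x hx.2, hx.1⟩, fun hx => ⟨hx.2, h.lower _ (h.quantile_mem hv) hx⟩⟩
    rw [h2, Real.volume_Ioo, sub_zero]
  simp_rw [e1]
  rw [lintegral_lintegral_swap hm.aemeasurable]
  exact setLIntegral_congr_fun measurableSet_Ioo e2

end IsRegularQuantile

/-- Change of variables along a map with a push-forward density. -/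
lemma integral_comp_of_map_eq_withDensity {α β : Type*} [MeasurableSpace α] [MeasurableSpace β]
    {μ : Measure α} {ν : Measure β} {T : α → β} {ρ : β → ℝ} (hT : Measurable T)
    (hρ : Measurable ρ) (hρ0 : ∀ᵐ v ∂ν, 0 ≤ ρ v)
    (h : μ.map T = ν.withDensity fun v => ENNReal.ofReal (ρ v)) {F : β → ℝ}
    (hF : AEStronglyMeasurable F ν) :
    (Integrable (fun v => ρ v * F v) ν ↔ Integrable (fun x => F (T x)) μ) ∧
      ∫ v, ρ v * F v ∂ν = ∫ x, F (T x) ∂μ := by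
  have hF' : AEStronglyMeasurable F (μ.map T) := by
    rw [h]; exact hF.mono_ac (withDensity_absolutelyContinuous _ _)
  have e : (fun v => (ENNReal.ofReal (ρ v)).toReal • F v) =ᵐ[ν] fun v => ρ v * F v := by
    filter_upwards [hρ0] with v hv
    rw [ENNReal.toReal_ofReal hv, smul_eq_mul]
  constructor
  · rw [← integrable_congr e, ← integrable_withDensity_iff_integrable_smul' (by fun_prop)
      (ae_of_all _ fun v => ENNReal.ofReal_lt_top), ← h, integrable_map_measure hF' hT.aemeasurable]
    rfl
  · rw [← integral_congr_ae e, ← integral_withDensity_eq_integral_toReal_smul (by fun_prop)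
      (ae_of_all _ fun v => ENNReal.ofReal_lt_top), ← h, integral_map hT.aemeasurable hF']

namespace IsRegularQuantile

variable {D D' : Set ℝ} {G g Q G' g' Q' : ℝ → ℝ}

/-- The substitution v = 1 - G(x), in which the quantile density 1/g cancels the Jacobian g.
Integrability is part of the conclusion since `D` may be unbounded. -/
lemma change_var (h : IsRegularQuantile D G g Q) {F : ℝ → ℝ}
    (hF : ContinuousOn F (Set.Icc 0 1)) :
    (IntegrableOn (fun v => deriv Q (1 - v) * F v) (Set.Icc 0 1) ↔
      IntegrableOn (fun x => F (1 - G x)) D) ∧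
    ∫ v in Set.Icc (0 : ℝ) 1, deriv Q (1 - v) * F v = ∫ x in D, F (1 - G x) :=
  integral_comp_of_map_eq_withDensity (by have := h.continuous.measurable; fun_prop)
    ((measurable_deriv Q).comp (measurable_const.sub measurable_id)) h.deriv_quantile_nonneg
    h.map_one_sub (hF.aestronglyMeasurable measurableSet_Icc)

lemma change_var₂ (h : IsRegularQuantile D G g Q) (h' : IsRegularQuantile D' G' g' Q')
    {F : ℝ × ℝ → ℝ} (hF : ContinuousOn F (Set.Icc 0 1 ×ˢ Set.Icc 0 1)) :
    (IntegrableOn (fun p : ℝ × ℝ => deriv Q (1 - p.1) * deriv Q' (1 - p.2) * F p)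
        (Set.Icc 0 1 ×ˢ Set.Icc 0 1) ↔
      IntegrableOn (fun p : ℝ × ℝ => F (1 - G p.1, 1 - G' p.2)) (D ×ˢ D')) ∧
    ∫ p in Set.Icc (0 : ℝ) 1 ×ˢ Set.Icc (0 : ℝ) 1, deriv Q (1 - p.1) * deriv Q' (1 - p.2) * F p =
      ∫ p in D ×ˢ D', F (1 - G p.1, 1 - G' p.2) := by
  have hm := h.continuous.measurable
  have hm' := h'.continuous.measurable
  have hq : Measurable fun v => deriv Q (1 - v) :=
    (measurable_deriv Q).comp (measurable_const.sub measurable_id)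
  have hq' : Measurable fun v => deriv Q' (1 - v) :=
    (measurable_deriv Q').comp (measurable_const.sub measurable_id)
  have hnn : ∀ᵐ p ∂squareMeasure, 0 ≤ deriv Q (1 - p.1) := by
    rw [squareMeasure_eq_prod]
    exact Measure.quasiMeasurePreserving_fst.ae h.deriv_quantile_nonneg
  have hnn' : ∀ᵐ p ∂squareMeasure, 0 ≤ deriv Q' (1 - p.2) := by
    rw [squareMeasure_eq_prod]
    exact Measure.quasiMeasurePreserving_snd.ae h'.deriv_quantile_nonneg
  refine integral_comp_of_map_eq_withDensity (ν := squareMeasure)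
    (μ := volume.restrict (D ×ˢ D')) (T := fun p => (1 - G p.1, 1 - G' p.2))
    (ρ := fun p => deriv Q (1 - p.1) * deriv Q' (1 - p.2)) (by fun_prop)
    ((hq.comp measurable_fst).mul (hq'.comp measurable_snd)) ?_ ?_
    (hF.aestronglyMeasurable (measurableSet_Icc.prod measurableSet_Icc))
  · filter_upwards [hnn, hnn'] with p h1 h2
    exact mul_nonneg h1 h2
  · have e : (volume.restrict (D ×ˢ D') : Measure (ℝ × ℝ)) =
        (volume.restrict D).prod (volume.restrict D') := by
      rw [Measure.prod_restrict]; rfl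
    have e2 : (fun p : ℝ × ℝ => (1 - G p.1, 1 - G' p.2)) =
        Prod.map (fun x => 1 - G x) (fun y => 1 - G' y) := rfl
    have : SFinite (Measure.map (fun x => 1 - G x) (volume.restrict D)) := inferInstance
    rw [e, e2, ← Measure.map_prod_map _ _ (by fun_prop) (by fun_prop), h.map_one_sub,
      h'.map_one_sub, prod_withDensity (by fun_prop) (by fun_prop), ← squareMeasure_eq_prod]
    refine withDensity_congr_ae ?_
    filter_upwards [hnn] with p h1
    rw [ENNReal.ofReal_mul h1]

end IsRegularQuantile

/-! ### The Beta and Gamma laws: moments and tails -/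

lemma isRegularQuantile_beta {m : ℕ} (hm : 1 ≤ m) :
    IsRegularQuantile (Set.Ioo 0 1) (G₃ m) (betaPDFReal m m) (Q₃ m) := by
  have hm' : (0 : ℝ) < m := by exact_mod_cast hm
  have := isProbabilityMeasureBeta hm' hm'
  refine isRegularQuantile_of_density (μ := betaMeasure m m) rfl isOpen_Ioo (fun x hx => hx.1)
    (fun x hx y hy => ⟨hy.1, hy.2.trans hx.2⟩) (by fun_prop) (fun x hx _ => ?_)
    (fun x hx => betaPDFReal_pos hx.1 hx.2 hm' hm') (fun x hx => ?_) fun v => rfl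
  · exact if_neg hx
  · refine ContinuousAt.congr (f := fun x => (1 / beta m m) * x ^ ((m : ℝ) - 1) *
      (1 - x) ^ ((m : ℝ) - 1)) ?_ ?_
    · refine (continuousAt_const.mul (continuousAt_id.rpow_const (Or.inl hx.1.ne'))).mul
        ((continuousAt_const.sub continuousAt_id).rpow_const (Or.inl (sub_pos.2 hx.2).ne'))
    · filter_upwards [isOpen_Ioo.mem_nhds hx] with y hy
      exact (if_pos (show 0 < y ∧ y < 1 from hy)).symm

lemma isRegularQuantile_gamma {m : ℕ} (hm : 1 ≤ m) :
    IsRegularQuantile (Set.Ioi 0) (G₂ m) (gammaPDFReal (2 * m) 1) (Q₂ m) := by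
  have hm' : (0 : ℝ) < 2 * m := by have : (0 : ℝ) < m := by exact_mod_cast hm
                                   positivity
  have := isProbabilityMeasure_gammaMeasure hm' one_pos
  refine isRegularQuantile_of_density (μ := gammaMeasure (2 * m) 1) rfl isOpen_Ioi (fun x hx => hx)
    (fun x hx y hy => hy.1) (by fun_prop) (fun x hx h0 => ?_)
    (fun x hx => gammaPDFReal_pos hm' one_pos hx) (fun x hx => ?_) fun v => rfl
  · rw [gammaPDFReal, if_neg]
    exact fun h => hx (lt_of_le_of_ne h h0.symm)
  · refine ContinuousAt.congr (f := fun x => 1 ^ ((2 : ℝ) * m) / (Real.Gamma (2 * m)) *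
      x ^ ((2 : ℝ) * m - 1) * Real.exp (-(1 * x))) ?_ ?_
    · refine (continuousAt_const.mul (continuousAt_id.rpow_const (Or.inl (ne_of_gt hx)))).mul
        (by fun_prop)
    · filter_upwards [isOpen_Ioi.mem_nhds hx] with y hy
      rw [gammaPDFReal, if_pos (le_of_lt hy)]

lemma integral_betaPDFReal {a b : ℝ} (ha : 0 < a) (hb : 0 < b) :
    IntegrableOn (betaPDFReal a b) (Set.Ioo 0 1) ∧ ∫ x in Set.Ioo 0 1, betaPDFReal a b x = 1 := by
  have h := lintegral_betaPDF_eq_one ha hb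
  have hnn : ∀ x, 0 ≤ betaPDFReal a b x := by
    intro x
    by_cases hx : 0 < x ∧ x < 1
    · exact (betaPDFReal_pos hx.1 hx.2 ha hb).le
    · exact (if_neg hx).ge
  have hi : Integrable (betaPDFReal a b) :=
    (lintegral_ofReal_ne_top_iff_integrable (by fun_prop) (ae_of_all _ hnn)).1
      (by rw [show ∫⁻ x, ENNReal.ofReal (betaPDFReal a b x) = 1 from h]; simp)
  refine ⟨hi.integrableOn, ?_⟩
  rw [setIntegral_eq_integral_of_forall_compl_eq_zero
    (f := betaPDFReal a b) (fun x (hx : x ∉ Set.Ioo 0 1) => if_neg hx),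
    integral_eq_lintegral_of_nonneg_ae (ae_of_all _ hnn) (by fun_prop),
    show ∫⁻ x, ENNReal.ofReal (betaPDFReal a b x) = 1 from h]
  simp

lemma integral_gammaPDFReal {a r : ℝ} (ha : 0 < a) (hr : 0 < r) :
    Integrable (gammaPDFReal a r) ∧ ∫ x in Set.Ioi 0, gammaPDFReal a r x = 1 := by
  have h := lintegral_gammaPDF_eq_one ha hr
  have hnn := gammaPDFReal_nonneg ha hr
  have hi : Integrable (gammaPDFReal a r) :=
    (lintegral_ofReal_ne_top_iff_integrable (by fun_prop) (ae_of_all _ hnn)).1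
      (by rw [show ∫⁻ x, ENNReal.ofReal (gammaPDFReal a r x) = 1 from h]; simp)
  refine ⟨hi, ?_⟩
  rw [← integral_Ici_eq_integral_Ioi, setIntegral_eq_integral_of_forall_compl_eq_zero
    (f := gammaPDFReal a r) (fun x (hx : x ∉ Set.Ici 0) => if_neg hx),
    integral_eq_lintegral_of_nonneg_ae (ae_of_all _ hnn) (by fun_prop),
    show ∫⁻ x, ENNReal.ofReal (gammaPDFReal a r x) = 1 from h]
  simp

/-- A power of x only shifts the first parameter, so moments are ratios of normalising constants. -/
lemma betaPDFReal_mul_pow {a b x : ℝ} (ha : 0 < a) (hb : 0 < b) (k : ℕ)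
    (hx : x ∈ Set.Ioo (0 : ℝ) 1) :
    betaPDFReal a b x * x ^ k = beta (a + k) b / beta a b * betaPDFReal (a + k) b x := by
  have h1 := (beta_pos ha hb).ne'
  have h2 := (beta_pos (by positivity : 0 < a + k) hb).ne'
  rw [betaPDFReal, betaPDFReal, if_pos (show 0 < x ∧ x < 1 from hx),
    if_pos (show 0 < x ∧ x < 1 from hx), show a + (k : ℝ) - 1 = a - 1 + k by ring, Real.rpow_add hx.1, Real.rpow_natCast]
  field_simp

lemma gammaPDFReal_mul_pow {a x : ℝ} (ha : 0 < a) (k : ℕ) (hx : x ∈ Set.Ioi (0 : ℝ)) :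
    gammaPDFReal a 1 x * x ^ k =
      Real.Gamma (a + k) / Real.Gamma a * gammaPDFReal (a + k) 1 x := by
  have h1 := (Real.Gamma_pos_of_pos ha).ne'
  have h2 := (Real.Gamma_pos_of_pos (by positivity : 0 < a + k)).ne'
  rw [gammaPDFReal, gammaPDFReal, if_pos (le_of_lt hx), if_pos (le_of_lt hx),
    show a + (k : ℝ) - 1 = a - 1 + k by ring, Real.rpow_add hx, Real.rpow_natCast,
    Real.one_rpow, Real.one_rpow]
  field_simp

lemma moment_Q₃ {m : ℕ} (hm : 1 ≤ m) (k : ℕ) :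
    IntegrableOn (fun v => Q₃ m v ^ k) (Set.Icc (0 : ℝ) 1) ∧
      ∫ v in Set.Icc (0 : ℝ) 1, Q₃ m v ^ k = beta (m + k) m / beta m m := by
  have hm' : (0 : ℝ) < m := by exact_mod_cast hm
  have h := isRegularQuantile_beta hm
  have hI := integral_betaPDFReal (by positivity : 0 < (m : ℝ) + k) hm'
  constructor
  · refine h.integrable_comp_quantile (φ := fun x => x ^ k) ?_
    exact IntegrableOn.congr_fun (hI.1.const_mul _)
      (fun x hx => (betaPDFReal_mul_pow hm' hm' k hx).symm) measurableSet_Ioo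
  · rw [h.integral_comp_quantile fun x => x ^ k, setIntegral_congr_fun measurableSet_Ioo
      fun x hx => betaPDFReal_mul_pow hm' hm' k hx, integral_const_mul, hI.2, mul_one]

lemma moment_Q₂ {m : ℕ} (hm : 1 ≤ m) (k : ℕ) :
    IntegrableOn (fun v => Q₂ m v ^ k) (Set.Icc (0 : ℝ) 1) ∧
      ∫ v in Set.Icc (0 : ℝ) 1, Q₂ m v ^ k = Real.Gamma (2 * m + k) / Real.Gamma (2 * m) := by
  have hm' : (0 : ℝ) < m := by exact_mod_cast hm
  have h := isRegularQuantile_gamma hm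
  have hI := integral_gammaPDFReal (by positivity : 0 < 2 * (m : ℝ) + k) one_pos
  constructor
  · refine h.integrable_comp_quantile (φ := fun x => x ^ k) ?_
    exact IntegrableOn.congr_fun (hI.1.integrableOn.const_mul _)
      (fun x hx => (gammaPDFReal_mul_pow (by positivity) k hx).symm) measurableSet_Ioi
  · rw [h.integral_comp_quantile fun x => x ^ k, setIntegral_congr_fun measurableSet_Ioi
      fun x hx => gammaPDFReal_mul_pow (by positivity) k hx, integral_const_mul, hI.2, mul_one]

lemma integral_Q₃ {m : ℕ} (hm : 1 ≤ m) : ∫ v in Set.Icc (0 : ℝ) 1, Q₃ m v = 1 / 2 := by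
  have hm' : (0 : ℝ) < m := by exact_mod_cast hm
  have h := (moment_Q₃ hm 1).2
  simp only [pow_one, Nat.cast_one] at h
  have h1 := (Real.Gamma_pos_of_pos hm').ne'
  have h2 := (Real.Gamma_pos_of_pos (by positivity : (0 : ℝ) < m + m)).ne'
  rw [h, beta, beta, show (m : ℝ) + 1 + m = m + m + 1 by ring, Real.Gamma_add_one hm'.ne',
    Real.Gamma_add_one (by positivity)]
  field_simp
  ring

lemma integral_Q₃_sq {m : ℕ} (hm : 1 ≤ m) :
    ∫ v in Set.Icc (0 : ℝ) 1, Q₃ m v ^ 2 = (m + 1) / (2 * (2 * m + 1)) := by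
  have hm' : (0 : ℝ) < m := by exact_mod_cast hm
  have h1 := (Real.Gamma_pos_of_pos hm').ne'
  have h2 := (Real.Gamma_pos_of_pos (by positivity : (0 : ℝ) < m + m)).ne'
  rw [(moment_Q₃ hm 2).2, beta, beta, Nat.cast_ofNat, show (m : ℝ) + 2 + m = m + m + 1 + 1 by ring,
    show (m : ℝ) + 2 = m + 1 + 1 by ring,
    Real.Gamma_add_one (by positivity), Real.Gamma_add_one hm'.ne',
    Real.Gamma_add_one (by positivity), Real.Gamma_add_one (by positivity)]
  field_simp
  ring

lemma integral_Q₂ {m : ℕ} (hm : 1 ≤ m) : ∫ v in Set.Icc (0 : ℝ) 1, Q₂ m v = 2 * m := by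
  have hm' : (0 : ℝ) < m := by exact_mod_cast hm
  have h := (moment_Q₂ hm 1).2
  simp only [pow_one, Nat.cast_one] at h
  have h1 := (Real.Gamma_pos_of_pos (by positivity : (0 : ℝ) < 2 * m)).ne'
  rw [h, Real.Gamma_add_one (by positivity)]
  field_simp

lemma integral_Q₂_sq {m : ℕ} (hm : 1 ≤ m) :
    ∫ v in Set.Icc (0 : ℝ) 1, Q₂ m v ^ 2 = 2 * m * (2 * m + 1) := by
  have hm' : (0 : ℝ) < m := by exact_mod_cast hm
  have h1 := (Real.Gamma_pos_of_pos (by positivity : (0 : ℝ) < 2 * m)).ne'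
  rw [(moment_Q₂ hm 2).2, Nat.cast_ofNat, show 2 * (m : ℝ) + 2 = 2 * m + 1 + 1 by ring,
    Real.Gamma_add_one (by positivity), Real.Gamma_add_one (by positivity)]
  field_simp

/-- Half of the exponential rate is spent on the tail: for x > y the rate-1 density is at most
2^(2m) exp(-y/2) times the rate-1/2 density, whose mass is at most 1. -/
lemma tail_G₂ {m : ℕ} (hm : 1 ≤ m) (y : ℝ) (hy : 0 ≤ y) :
    1 - G₂ m y ≤ 2 ^ (2 * (m : ℝ)) * Real.exp (-(1 / 2) * y) := by
  have hm' : (0 : ℝ) < m := by exact_mod_cast hm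
  have h2m : (0 : ℝ) < 2 * m := by positivity
  have := isProbabilityMeasure_gammaMeasure h2m one_pos
  have hI := integral_gammaPDFReal h2m one_pos
  have hI2 := integral_gammaPDFReal h2m (one_half_pos (α := ℝ))
  have e1 : 1 - G₂ m y = ∫ x in Set.Ioi y, gammaPDFReal (2 * m) 1 x := by
    have h3 := probReal_compl_eq_one_sub (μ := gammaMeasure (2 * m) 1) (measurableSet_Iic (a := y))
    rw [← cdf_eq_real, Set.compl_Iic] at h3
    rw [G₂, ← h3, measureReal_def, gammaMeasure, withDensity_apply _ measurableSet_Ioi,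
      integral_eq_lintegral_of_nonneg_ae (ae_of_all _ (gammaPDFReal_nonneg h2m one_pos))
        (by fun_prop)]
    rfl
  have e2 : ∀ x ∈ Set.Ioi y, gammaPDFReal (2 * m) 1 x ≤
      2 ^ (2 * (m : ℝ)) * Real.exp (-(1 / 2) * y) * gammaPDFReal (2 * m) (1 / 2) x := by
    intro x hx
    have hx0 : 0 ≤ x := hy.trans (le_of_lt hx)
    rw [gammaPDFReal, gammaPDFReal, if_pos hx0, if_pos hx0, Real.one_rpow]
    have h4 : (2 : ℝ) ^ (2 * (m : ℝ)) * (1 / 2) ^ (2 * (m : ℝ)) = 1 := by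
      rw [← Real.mul_rpow (by norm_num) (by norm_num)]; norm_num
    have h5 : Real.exp (-(1 * x)) ≤ Real.exp (-(1 / 2) * y) * Real.exp (-(1 / 2 * x)) := by
      rw [← Real.exp_add]
      exact Real.exp_le_exp.2 (by linarith [Set.mem_Ioi.1 hx])
    have h6 : 0 ≤ 1 / Real.Gamma (2 * m) * x ^ (2 * (m : ℝ) - 1) := by
      have := Real.Gamma_pos_of_pos h2m
      positivity
    calc _ ≤ 1 / Real.Gamma (2 * m) * x ^ (2 * (m : ℝ) - 1) *
          (Real.exp (-(1 / 2) * y) * Real.exp (-(1 / 2 * x))) := by gcongr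
      _ = (2 : ℝ) ^ (2 * (m : ℝ)) * (1 / 2) ^ (2 * (m : ℝ)) *
          (1 / Real.Gamma (2 * m) * x ^ (2 * (m : ℝ) - 1) *
          (Real.exp (-(1 / 2) * y) * Real.exp (-(1 / 2 * x)))) := by rw [h4, one_mul]
      _ = _ := by ring
  rw [e1]
  calc _ ≤ ∫ x in Set.Ioi y, 2 ^ (2 * (m : ℝ)) * Real.exp (-(1 / 2) * y) *
        gammaPDFReal (2 * m) (1 / 2) x :=
        setIntegral_mono_on hI.1.integrableOn (hI2.1.const_mul _).integrableOn measurableSet_Ioi e2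
    _ = 2 ^ (2 * (m : ℝ)) * Real.exp (-(1 / 2) * y) *
        ∫ x in Set.Ioi y, gammaPDFReal (2 * m) (1 / 2) x := by rw [integral_const_mul]
    _ ≤ 2 ^ (2 * (m : ℝ)) * Real.exp (-(1 / 2) * y) * 1 := by
        gcongr
        refine le_trans ?_ hI2.2.le
        exact setIntegral_mono_set hI2.1.integrableOn
          (ae_of_all _ (gammaPDFReal_nonneg h2m one_half_pos))
          (Set.Ioi_subset_Ioi hy).eventuallyLE
    _ = _ := mul_one _

/-! ### Pathwise identities for almost every path -/

lemma integral_comp_one_sub (F : ℝ → ℝ) :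
    ∫ w in Set.Icc (0 : ℝ) 1, F (1 - w) = ∫ w in Set.Icc (0 : ℝ) 1, F w := by
  have h := intervalIntegral.integral_comp_sub_left (a := 0) (b := 1) F 1
  simp only [sub_self, sub_zero] at h
  rwa [intervalIntegral.integral_of_le zero_le_one, intervalIntegral.integral_of_le zero_le_one,
    ← integral_Icc_eq_integral_Ioc, ← integral_Icc_eq_integral_Ioc] at h

lemma integrableOn_comp_one_sub {F : ℝ → ℝ} (h : IntegrableOn F (Set.Icc 0 1)) :
    IntegrableOn (fun w => F (1 - w)) (Set.Icc (0 : ℝ) 1) := by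
  rw [← intervalIntegrable_iff_integrableOn_Icc_of_le zero_le_one] at h ⊢
  simpa using (h.comp_sub_left 1).symm

/-- The properties shared by almost all paths of a bridge. -/
structure IsGoodPath {Ω : Type*} (m : ℕ) (B : ℝ → ℝ → Ω → ℝ) (ω : Ω) : Prop where
  cont : ContinuousOn (fun p : ℝ × ℝ => B p.1 p.2 ω) (Set.Icc 0 1 ×ˢ Set.Icc 0 1)
  one_one : B 1 1 ω = 0
  zero_left : ∀ v ∈ Set.Icc (0 : ℝ) 1, B 0 v ω = 0
  zero_right : ∀ v ∈ Set.Icc (0 : ℝ) 1, B v 0 ω = 0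
  int : IntegrableOn (fun p : ℝ × ℝ => corner B (G₃ m p.1) (G₂ m p.2) ω) (Set.Icc 0 1 ×ˢ Set.Ici 0)
  int_zero : IntegrableOn (fun p : ℝ × ℝ => corner B 0 (G₂ m p.2) ω) (Set.Icc 0 1 ×ˢ Set.Ici 0)

lemma IsBivariateBrownianBridge.ae_isGoodPath {Ω : Type*} [MeasurableSpace Ω] {P : Measure Ω}
    {B : ℝ → ℝ → Ω → ℝ} (hB : IsBivariateBrownianBridge B P) {m : ℕ} (hm : 1 ≤ m) :
    ∀ᵐ ω ∂P, IsGoodPath m B ω := by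
  have h3 := isRegularQuantile_beta hm
  have h2 := isRegularQuantile_gamma hm
  filter_upwards [hB.continuous_paths, hB.boundary,
    hB.integrableOn_corner h3.continuous h2.continuous h3.mem_Icc h2.mem_Icc (tail_G₂ hm),
    hB.integrableOn_corner (g := fun _ => 0) continuous_const h2.continuous (fun _ => by simp)
      h2.mem_Icc (tail_G₂ hm)] with ω a1 a2 a3 a4
  exact ⟨a1, a2.1, fun v hv => (a2.2 v hv).1, fun v hv => (a2.2 v hv).2, a3, a4⟩

lemma square_ae_eq : (Set.Ioo (0 : ℝ) 1 ×ˢ Set.Ioi (0 : ℝ) : Set (ℝ × ℝ)) =ᵐ[volume]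
    (Set.Icc (0 : ℝ) 1 ×ˢ Set.Ici (0 : ℝ) : Set (ℝ × ℝ)) := by
  rw [Measure.volume_eq_prod]
  exact Measure.set_prod_ae_eq Ioo_ae_eq_Icc Ioi_ae_eq_Ici

/-- Integrals on the strip of a function of the second coordinate. -/
lemma integral_strip_snd {φ : ℝ → ℝ} :
    ∫ p in Set.Icc (0 : ℝ) 1 ×ˢ Set.Ici (0 : ℝ), φ p.2 = ∫ y in Set.Ici (0 : ℝ), φ y := by
  have := setIntegral_prod_mul (μ := volume) (ν := volume) (fun _ : ℝ => (1 : ℝ)) φ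
    (Set.Icc (0 : ℝ) 1) (Set.Ici (0 : ℝ))
  simpa [Measure.volume_eq_prod] using this

lemma integrableOn_of_strip_snd {φ : ℝ → ℝ}
    (h : IntegrableOn (fun p : ℝ × ℝ => φ p.2) (Set.Icc (0 : ℝ) 1 ×ˢ Set.Ici (0 : ℝ))) :
    IntegrableOn φ (Set.Ici 0) := by
  rw [IntegrableOn, Measure.volume_eq_prod, ← Measure.prod_restrict] at h
  exact h.prod_right_ae.exists.choose_spec

lemma tail_Q₃ {m : ℕ} (hm : 1 ≤ m) :
    IntegrableOn (fun v => q₃ m (1 - v) * v) (Set.Icc 0 1) ∧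
      ∫ v in Set.Icc (0 : ℝ) 1, q₃ m (1 - v) * v = 1 / 2 := by
  have h3 := isRegularQuantile_beta hm
  have e : ∫ v in Set.Icc (0 : ℝ) 1, q₃ m (1 - v) * v = 1 / 2 := by
    rw [← integral_Q₃ hm, ← h3.integral_one_sub]
    exact (h3.change_var continuousOn_id).2
  refine ⟨?_, e⟩
  -- Integrability comes for free: a non-integrable function has integral 0 by convention, while the
  -- value found is nonzero.
  by_contra hcon
  rw [integral_undef hcon] at e
  norm_num at e

lemma tail_Q₂ {m : ℕ} (hm : 1 ≤ m) :
    IntegrableOn (fun v => q₂ m (1 - v) * v) (Set.Icc 0 1) ∧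
      ∫ v in Set.Icc (0 : ℝ) 1, q₂ m (1 - v) * v = 2 * m := by
  have hm' : (0 : ℝ) < m := by exact_mod_cast hm
  have h2 := isRegularQuantile_gamma hm
  have e : ∫ v in Set.Icc (0 : ℝ) 1, q₂ m (1 - v) * v = 2 * m := by
    rw [← integral_Q₂ hm, ← h2.integral_one_sub]
    exact (h2.change_var continuousOn_id).2
  refine ⟨?_, e⟩
  by_contra hcon
  rw [integral_undef hcon] at e
  linarith

namespace IsGoodPath

variable {Ω : Type*} {m : ℕ} {B : ℝ → ℝ → Ω → ℝ} {ω : Ω}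

/-- The two sides differ only by the term B(1,1), which vanishes on a good path. -/
lemma star_eq (h : IsGoodPath m B ω) (s t : ℝ) :
    star B (1 - s) (1 - t) ω = corner B s t ω := by
  simp only [star, corner, sub_sub_cancel, h.one_one]; ring

lemma star_one_eq (h : IsGoodPath m B ω) (t : ℝ) :
    star B 1 (1 - t) ω = corner B 0 t ω := by
  have := h.star_eq 0 t
  rwa [sub_zero] at this

lemma star_right_one_eq (h : IsGoodPath m B ω) (s : ℝ) :
    star B (1 - s) 1 ω = corner B s 0 ω := by
  have := h.star_eq s 0
  rwa [sub_zero] at this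

lemma corner_zero_left (h : IsGoodPath m B ω) {t : ℝ} (ht : t ∈ Set.Icc (0 : ℝ) 1) :
    corner B 0 t ω = -B 1 t ω := by
  simp [corner, h.one_one, h.zero_left t ht, h.zero_left 1 (by simp)]

lemma corner_zero_right (h : IsGoodPath m B ω) {s : ℝ} (hs : s ∈ Set.Icc (0 : ℝ) 1) :
    corner B s 0 ω = -B s 1 ω := by
  simp [corner, h.one_one, h.zero_right s hs, h.zero_right 1 (by simp)]

lemma continuousOn_star (h : IsGoodPath m B ω) :
    ContinuousOn (fun p : ℝ × ℝ => star B p.1 p.2 ω) (Set.Icc 0 1 ×ˢ Set.Icc 0 1) := by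
  have h1 : (1 : ℝ) ∈ Set.Icc (0 : ℝ) 1 := by simp
  have hs : ∀ {x : ℝ}, x ∈ Set.Icc (0 : ℝ) 1 → 1 - x ∈ Set.Icc (0 : ℝ) 1 := fun hx =>
    ⟨by linarith [hx.2], by linarith [hx.1]⟩
  have e0 : ContinuousOn (fun p : ℝ × ℝ => B (1 - p.1) (1 - p.2) ω)
      (Set.Icc 0 1 ×ˢ Set.Icc 0 1) :=
    h.cont.comp (f := fun p : ℝ × ℝ => (1 - p.1, 1 - p.2)) (by fun_prop)
      fun p hp => ⟨hs hp.1, hs hp.2⟩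
  have e1 : ContinuousOn (fun p : ℝ × ℝ => B (1 - p.1) 1 ω) (Set.Icc 0 1 ×ˢ Set.Icc 0 1) :=
    h.cont.comp (f := fun p : ℝ × ℝ => (1 - p.1, (1 : ℝ))) (by fun_prop)
      fun p hp => ⟨hs hp.1, h1⟩
  have e2 : ContinuousOn (fun p : ℝ × ℝ => B 1 (1 - p.2) ω) (Set.Icc 0 1 ×ˢ Set.Icc 0 1) :=
    h.cont.comp (f := fun p : ℝ × ℝ => ((1 : ℝ), 1 - p.2)) (by fun_prop)
      fun p hp => ⟨h1, hs hp.2⟩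
  exact (e0.sub e1).sub e2

lemma continuousOn_star₁ (h : IsGoodPath m B ω) :
    ContinuousOn (fun v : ℝ => star B v 1 ω) (Set.Icc 0 1) :=
  h.continuousOn_star.comp (f := fun v : ℝ => (v, (1 : ℝ))) (by fun_prop)
    fun v hv => ⟨hv, by simp⟩

lemma continuousOn_star₂ (h : IsGoodPath m B ω) :
    ContinuousOn (fun v : ℝ => star B 1 v ω) (Set.Icc 0 1) :=
  h.continuousOn_star.comp (f := fun v : ℝ => ((1 : ℝ), v)) (by fun_prop)
    fun v hv => ⟨by simp, hv⟩

lemma continuousOn_star₀ (h : IsGoodPath m B ω) :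
    ContinuousOn (fun p : ℝ × ℝ => star₀ B p.1 p.2 ω) (Set.Icc 0 1 ×ˢ Set.Icc 0 1) := by
  refine (h.continuousOn_star.sub (continuousOn_fst.mul ?_)).sub (continuousOn_snd.mul ?_)
  · exact h.continuousOn_star₂.comp continuousOn_snd fun p hp => hp.2
  · exact h.continuousOn_star₁.comp continuousOn_fst fun p hp => hp.1

lemma integral_star (h : IsGoodPath m B ω) (hm : 1 ≤ m) :
    IntegrableOn (fun p : ℝ × ℝ => q₃ m (1 - p.1) * q₂ m (1 - p.2) * star B p.1 p.2 ω)
      (Set.Icc 0 1 ×ˢ Set.Icc 0 1) ∧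
    ∫ p in Set.Icc (0 : ℝ) 1 ×ˢ Set.Icc (0 : ℝ) 1,
      q₃ m (1 - p.1) * q₂ m (1 - p.2) * star B p.1 p.2 ω =
    ∫ p in Set.Icc (0 : ℝ) 1 ×ˢ Set.Ici (0 : ℝ), corner B (G₃ m p.1) (G₂ m p.2) ω := by
  have hc := (isRegularQuantile_beta hm).change_var₂ (isRegularQuantile_gamma hm)
    h.continuousOn_star
  simp only [h.star_eq] at hc
  rw [integrableOn_congr_set_ae square_ae_eq, setIntegral_congr_set square_ae_eq] at hc
  exact ⟨hc.1.2 h.int, hc.2⟩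

lemma integral_star₂ (h : IsGoodPath m B ω) (hm : 1 ≤ m) :
    IntegrableOn (fun w : ℝ => q₂ m (1 - w) * star B 1 w ω) (Set.Icc 0 1) ∧
    ∫ w in Set.Icc (0 : ℝ) 1, q₂ m (1 - w) * star B 1 w ω =
    ∫ p in Set.Icc (0 : ℝ) 1 ×ˢ Set.Ici (0 : ℝ), corner B 0 (G₂ m p.2) ω := by
  have hc := (isRegularQuantile_gamma hm).change_var h.continuousOn_star₂
  simp only [h.star_one_eq] at hc
  rw [integral_strip_snd (φ := fun y => corner B 0 (G₂ m y) ω), integral_Ici_eq_integral_Ioi]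
  exact ⟨hc.1.2 ((integrableOn_of_strip_snd h.int_zero).mono_set Set.Ioi_subset_Ici_self), hc.2⟩

lemma continuous_corner₁ (h : IsGoodPath m B ω) (hm : 1 ≤ m) :
    Continuous fun x => corner B (G₃ m x) 0 ω := by
  have h3 := isRegularQuantile_beta hm
  have := h.continuousOn_star₁.comp_continuous (f := fun x => 1 - G₃ m x)
    (by have := h3.continuous; fun_prop)
    fun x => ⟨by linarith [(h3.mem_Icc x).2], by linarith [(h3.mem_Icc x).1]⟩
  simpa only [Function.comp_def, h.star_right_one_eq] using this

lemma integral_star₁ (h : IsGoodPath m B ω) (hm : 1 ≤ m) :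
    IntegrableOn (fun v : ℝ => q₃ m (1 - v) * star B v 1 ω) (Set.Icc 0 1) ∧
    ∫ v in Set.Icc (0 : ℝ) 1, q₃ m (1 - v) * star B v 1 ω =
    ∫ x in Set.Icc (0 : ℝ) 1, corner B (G₃ m x) 0 ω := by
  have hc := (isRegularQuantile_beta hm).change_var h.continuousOn_star₁
  simp only [h.star_right_one_eq] at hc
  rw [integral_Icc_eq_integral_Ioo (f := fun x => corner B (G₃ m x) 0 ω)]
  exact ⟨hc.1.2 (((h.continuous_corner₁ hm).integrableOn_Icc).mono_set Set.Ioo_subset_Icc_self),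
    hc.2⟩

/-- Both corrections in `star₀` are products of one-variable functions, so their integrals factor;
1/2 and 2m are the Beta and Gamma means. -/
lemma integral_star₀ (h : IsGoodPath m B ω) (hm : 1 ≤ m) :
    IntegrableOn (fun p : ℝ × ℝ => q₃ m (1 - p.1) * q₂ m (1 - p.2) * star₀ B p.1 p.2 ω)
      (Set.Icc 0 1 ×ˢ Set.Icc 0 1) ∧
    ∫ p in Set.Icc (0 : ℝ) 1 ×ˢ Set.Icc (0 : ℝ) 1,
      q₃ m (1 - p.1) * q₂ m (1 - p.2) * star₀ B p.1 p.2 ω =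
    (∫ p in Set.Icc (0 : ℝ) 1 ×ˢ Set.Ici (0 : ℝ), corner B (G₃ m p.1) (G₂ m p.2) ω) -
      1 / 2 * (∫ p in Set.Icc (0 : ℝ) 1 ×ˢ Set.Ici (0 : ℝ), corner B 0 (G₂ m p.2) ω) -
      2 * m * ∫ x in Set.Icc (0 : ℝ) 1, corner B (G₃ m x) 0 ω := by
  obtain ⟨i0, e0⟩ := h.integral_star hm
  obtain ⟨i1, e1⟩ := h.integral_star₁ hm
  obtain ⟨i2, e2⟩ := h.integral_star₂ hm
  have j1 : Integrable (fun p : ℝ × ℝ => (q₃ m (1 - p.1) * p.1) *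
      (q₂ m (1 - p.2) * star B 1 p.2 ω)) squareMeasure := by
    rw [squareMeasure_eq_prod]; exact Integrable.mul_prod (tail_Q₃ hm).1 i2
  have j2 : Integrable (fun p : ℝ × ℝ => (q₃ m (1 - p.1) * star B p.1 1 ω) *
      (q₂ m (1 - p.2) * p.2)) squareMeasure := by
    rw [squareMeasure_eq_prod]; exact Integrable.mul_prod i1 (tail_Q₂ hm).1
  have k1 : ∫ p : ℝ × ℝ, (q₃ m (1 - p.1) * p.1) * (q₂ m (1 - p.2) * star B 1 p.2 ω)
      ∂squareMeasure = 1 / 2 * ∫ p in Set.Icc (0 : ℝ) 1 ×ˢ Set.Ici (0 : ℝ),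
        corner B 0 (G₂ m p.2) ω := by
    rw [squareMeasure_eq_prod, integral_prod_mul (fun v => q₃ m (1 - v) * v)
      (fun w => q₂ m (1 - w) * star B 1 w ω), (tail_Q₃ hm).2, e2]
  have k2 : ∫ p : ℝ × ℝ, (q₃ m (1 - p.1) * star B p.1 1 ω) * (q₂ m (1 - p.2) * p.2)
      ∂squareMeasure = 2 * m * ∫ x in Set.Icc (0 : ℝ) 1, corner B (G₃ m x) 0 ω := by
    rw [squareMeasure_eq_prod, integral_prod_mul (fun v => q₃ m (1 - v) * star B v 1 ω)
      (fun w => q₂ m (1 - w) * w), (tail_Q₂ hm).2, e1, mul_comm]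
  have e : ∀ p : ℝ × ℝ, q₃ m (1 - p.1) * q₂ m (1 - p.2) * star₀ B p.1 p.2 ω =
      q₃ m (1 - p.1) * q₂ m (1 - p.2) * star B p.1 p.2 ω -
      (q₃ m (1 - p.1) * p.1) * (q₂ m (1 - p.2) * star B 1 p.2 ω) -
      (q₃ m (1 - p.1) * star B p.1 1 ω) * (q₂ m (1 - p.2) * p.2) := by
    intro p; rw [star₀]; ring
  simp_rw [e]
  refine ⟨(i0.sub j1).sub j2, ?_⟩
  rw [integral_sub (by exact i0.sub j1) j2, integral_sub i0 j1, k1, k2, e0]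

/-- Here integrability passes from the square to the strip: in the strip the separate corrections
are not of corner form, whereas on the square they are already controlled. -/
lemma integral_star₀_strip (h : IsGoodPath m B ω) (hm : 1 ≤ m) :
    IntegrableOn (fun p : ℝ × ℝ => star₀ B (1 - G₃ m p.1) (1 - G₂ m p.2) ω)
      (Set.Icc 0 1 ×ˢ Set.Ici 0) ∧
    ∫ p in Set.Icc (0 : ℝ) 1 ×ˢ Set.Icc (0 : ℝ) 1,
      q₃ m (1 - p.1) * q₂ m (1 - p.2) * star₀ B p.1 p.2 ω =
    ∫ p in Set.Icc (0 : ℝ) 1 ×ˢ Set.Ici (0 : ℝ), star₀ B (1 - G₃ m p.1) (1 - G₂ m p.2) ω := by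
  have hc := (isRegularQuantile_beta hm).change_var₂ (isRegularQuantile_gamma hm)
    h.continuousOn_star₀
  rw [integrableOn_congr_set_ae square_ae_eq, setIntegral_congr_set square_ae_eq] at hc
  exact ⟨hc.1.1 (h.integral_star₀ hm).1, hc.2⟩

lemma integral_reflect (h : IsGoodPath m B ω) (hm : 1 ≤ m) :
    IntegrableOn (fun w : ℝ => q₂ m w * B 1 w ω) (Set.Icc 0 1) ∧
    ∫ w in Set.Icc (0 : ℝ) 1, q₂ m (1 - w) * star B 1 w ω =
      -∫ w in Set.Icc (0 : ℝ) 1, q₂ m w * B 1 w ω := by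
  have e : ∀ w ∈ Set.Icc (0 : ℝ) 1, q₂ m (1 - (1 - w)) * star B 1 (1 - w) ω =
      -(q₂ m w * B 1 w ω) := by
    intro w hw
    rw [h.star_one_eq, h.corner_zero_left hw, sub_sub_cancel]; ring
  constructor
  · have h1 := integrableOn_comp_one_sub (h.integral_star₂ hm).1
    have h2 := (h1.congr_fun e measurableSet_Icc).neg
    refine IntegrableOn.congr_fun h2 (fun w _ => ?_) measurableSet_Icc
    simp
  · rw [← integral_comp_one_sub, setIntegral_congr_fun measurableSet_Icc e, integral_neg]

end IsGoodPath

/-! ### Variances, laws and independence -/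

section Laws

variable {Ω : Type*} [MeasurableSpace Ω] {P : Measure Ω} {B : ℝ → ℝ → Ω → ℝ}

/-- Centred Gaussian variables all of whose linear combinations have the laws they would have under
independence are independent. -/
lemma iIndepFun_of_hasLaw_sum [IsProbabilityMeasure P] {ι : Type*} [Fintype ι] {X : ι → Ω → ℝ}
    {σ : ι → ℝ≥0} (hX : ∀ i, HasLaw (X i) (gaussianReal 0 (σ i)) P)
    (h : ∀ t : ι → ℝ, HasLaw (fun ω => ∑ i, t i * X i ω)
      (gaussianReal 0 (∑ i, t i ^ 2 * (σ i : ℝ)).toNNReal) P) : iIndepFun X P := by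
  have hm : ∀ i, AEMeasurable (X i) P := fun i => (hX i).aemeasurable
  rw [iIndepFun_iff_charFun_pi hm]
  intro t
  have hm' : AEMeasurable (fun ω => WithLp.toLp 2 (fun i => X i ω)) P := by fun_prop
  -- The joint characteristic function at t is that of the single variable Σ tᵢXᵢ at 1, whose law is
  -- given.
  have h1 : charFun (P.map (fun ω => WithLp.toLp 2 (fun i => X i ω))) t =
      charFun (P.map (fun ω => ∑ i, t i * X i ω)) 1 := by
    rw [charFun_apply, charFun_apply, integral_map hm' (by fun_prop),
      integral_map (h t.ofLp).aemeasurable (by fun_prop)]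
    congr 1; ext ω
    congr 3
    simp [PiLp.inner_apply]
  rw [h1, (h t.ofLp).map_eq, charFun_gaussianReal]
  simp_rw [(hX _).map_eq, charFun_gaussianReal]
  rw [← Complex.exp_sum, Real.coe_toNNReal _ (Finset.sum_nonneg fun i _ => by positivity)]
  congr 1
  push_cast
  simp only [mul_zero, zero_mul, zero_sub, one_pow, mul_one, Finset.sum_neg_distrib,
    Finset.sum_div]
  congr 1
  exact Finset.sum_congr rfl fun i _ => by ring

lemma integrable_pow_mul {m : ℕ} (hm : 1 ≤ m) (i j : ℕ) :
    Integrable (fun p : ℝ × ℝ => Q₃ m p.1 ^ i * Q₂ m p.2 ^ j) squareMeasure := by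
  rw [squareMeasure_eq_prod]
  exact Integrable.mul_prod (moment_Q₃ hm i).1 (moment_Q₂ hm j).1

/-- Integrals of polynomials in the quantile functions. -/
lemma integral_poly {m : ℕ} (hm : 1 ≤ m) (c : Fin 3 → Fin 3 → ℝ) :
    ∫ p : ℝ × ℝ, ∑ i : Fin 3, ∑ j : Fin 3, c i j * (Q₃ m p.1 ^ (i : ℕ) * Q₂ m p.2 ^ (j : ℕ))
      ∂squareMeasure =
    ∑ i : Fin 3, ∑ j : Fin 3, c i j *
      ((![1, 1 / 2, (m + 1) / (2 * (2 * m + 1))] : Fin 3 → ℝ) i *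
        (![1, 2 * m, 2 * m * (2 * m + 1)] : Fin 3 → ℝ) j) := by
  have M3 : ∀ i : Fin 3, ∫ v in Set.Icc (0 : ℝ) 1, Q₃ m v ^ (i : ℕ) =
      (![1, 1 / 2, (m + 1) / (2 * (2 * m + 1))] : Fin 3 → ℝ) i := by
    intro i
    fin_cases i
    · simp
    · simpa using integral_Q₃ hm
    · simpa using integral_Q₃_sq hm
  have M2 : ∀ i : Fin 3, ∫ v in Set.Icc (0 : ℝ) 1, Q₂ m v ^ (i : ℕ) =
      (![1, 2 * m, 2 * m * (2 * m + 1)] : Fin 3 → ℝ) i := by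
    intro i
    fin_cases i
    · simp
    · simpa using integral_Q₂ hm
    · simpa using integral_Q₂_sq hm
  rw [integral_finsetSum _ fun i _ => integrable_finsetSum _ fun j _ =>
    (integrable_pow_mul hm _ _).const_mul _]
  refine Finset.sum_congr rfl fun i _ => ?_
  rw [integral_finsetSum _ fun j _ => (integrable_pow_mul hm _ _).const_mul _]
  refine Finset.sum_congr rfl fun j _ => ?_
  rw [integral_const_mul, squareMeasure_eq_prod,
    integral_prod_mul (fun v => Q₃ m v ^ (i : ℕ)) (fun w => Q₂ m w ^ (j : ℕ)), M3, M2]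

/-- The variance of a bilinear expression in the quantile functions. -/
lemma sqVar_quantiles {m : ℕ} (hm : 1 ≤ m) (a b c : ℝ) :
    sqVar (fun p => a * (Q₃ m p.1 * Q₂ m p.2) + b * Q₃ m p.1 + c * Q₂ m p.2) =
      a ^ 2 * (m / (2 * (2 * m + 1))) + (b + 2 * m * a) ^ 2 * (1 / (4 * (2 * m + 1))) +
        (c + a / 2) ^ 2 * (2 * m) := by
  have hm' : (0 : ℝ) < m := by exact_mod_cast hm
  -- The claimed value reflects the orthogonal splitting a(Q₃-1/2)(Q₂-2m) + (b+2ma)(Q₃-1/2) +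
  -- (c+a/2)(Q₂-2m) + constant, with Var Q₃ = 1/(4(2m+1)) and Var Q₂ = 2m. It is checked by
  -- expanding into moments of degree at most 2 in each variable.
  have e1 : ∀ p : ℝ × ℝ, a * (Q₃ m p.1 * Q₂ m p.2) + b * Q₃ m p.1 + c * Q₂ m p.2 =
      ∑ i : Fin 3, ∑ j : Fin 3, (![![0, c, 0], ![b, a, 0], ![0, 0, 0]] : Fin 3 → Fin 3 → ℝ) i j *
        (Q₃ m p.1 ^ (i : ℕ) * Q₂ m p.2 ^ (j : ℕ)) := by
    intro p
    simp [Fin.sum_univ_three]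
    ring
  have e2 : ∀ p : ℝ × ℝ, (a * (Q₃ m p.1 * Q₂ m p.2) + b * Q₃ m p.1 + c * Q₂ m p.2) ^ 2 =
      ∑ i : Fin 3, ∑ j : Fin 3, (![![0, 0, c ^ 2], ![0, 2 * b * c, 2 * a * c],
        ![b ^ 2, 2 * a * b, a ^ 2]] : Fin 3 → Fin 3 → ℝ) i j *
        (Q₃ m p.1 ^ (i : ℕ) * Q₂ m p.2 ^ (j : ℕ)) := by
    intro p
    simp [Fin.sum_univ_three]
    ring
  rw [sqVar, integral_congr_ae (ae_of_all _ e2), integral_congr_ae (ae_of_all _ e1),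
    integral_poly hm, integral_poly hm]
  simp [Fin.sum_univ_three]
  field_simp
  ring

/-- The mass of `(G₃ x, 1] × (G₂ y, 1]` integrated over the strip. -/
def stripInt {Ω : Type*} (m : ℕ) (B : ℝ → ℝ → Ω → ℝ) (ω : Ω) : ℝ :=
  ∫ p in Set.Icc (0 : ℝ) 1 ×ˢ Set.Ici (0 : ℝ), corner B (G₃ m p.1) (G₂ m p.2) ω

/-- The mass of `(0, 1] × (G₂ y, 1]` integrated over the strip. -/
def stripInt₂ {Ω : Type*} (m : ℕ) (B : ℝ → ℝ → Ω → ℝ) (ω : Ω) : ℝ :=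
  ∫ p in Set.Icc (0 : ℝ) 1 ×ˢ Set.Ici (0 : ℝ), corner B 0 (G₂ m p.2) ω

/-- The mass of `(G₃ x, 1] × (0, 1]` integrated over the unit interval. -/
def stripInt₁ {Ω : Type*} (m : ℕ) (B : ℝ → ℝ → Ω → ℝ) (ω : Ω) : ℝ :=
  ∫ x in Set.Icc (0 : ℝ) 1, corner B (G₃ m x) 0 ω

lemma ae_mem_open_square : ∀ᵐ p ∂squareMeasure,
    p.1 ∈ Set.Ioo (0 : ℝ) 1 ∧ p.2 ∈ Set.Ioo (0 : ℝ) 1 := by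
  have h : ∀ᵐ v : ℝ, v ≠ 0 ∧ v ≠ 1 := by
    filter_upwards [Measure.ae_ne volume (0 : ℝ), Measure.ae_ne volume (1 : ℝ)] with v h0 h1
    exact ⟨h0, h1⟩
  filter_upwards [ae_mem_square, ae_square_fst h, ae_square_snd h] with p hp h1 h2
  exact ⟨⟨lt_of_le_of_ne hp.1.1 h1.1.symm, lt_of_le_of_ne hp.1.2 h1.2⟩,
    ⟨lt_of_le_of_ne hp.2.1 h2.1.symm, lt_of_le_of_ne hp.2.2 h2.2⟩⟩

lemma levelAvg_zero {v : ℝ} (hv : 0 < v) : levelAvg (fun _ => 0) v = 1 := by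
  simp [levelAvg, stepInd_of_lt hv]

lemma levelAvg_G₃ {m : ℕ} (hm : 1 ≤ m) {v : ℝ} (hv : v ∈ Set.Ioo (0 : ℝ) 1) :
    levelAvg (G₃ m) v = Q₃ m v := by
  have h3 := isRegularQuantile_beta hm
  rw [levelAvg, h3.integral_stepInd hv zero_le_one]
  exact min_eq_left (h3.quantile_mem hv).2.le

lemma memLp_Q₂ {m : ℕ} (hm : 1 ≤ m) : MemLp (fun p : ℝ × ℝ => Q₂ m p.2) 2 squareMeasure := by
  have h1 := integrable_pow_mul hm 0 1
  have h2 := integrable_pow_mul hm 0 2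
  simp only [pow_zero, one_mul, pow_one] at h1 h2
  exact (memLp_two_iff_integrable_sq h1.aestronglyMeasurable).2 h2

lemma hasStochIntegral_Q₃_mul_Q₂ (hB : IsBivariateBrownianBridge B P) {m : ℕ} (hm : 1 ≤ m) :
    HasStochIntegral P B (fun p => Q₃ m p.1 * Q₂ m p.2) (stripInt m B) := by
  have h3 := isRegularQuantile_beta hm
  have h2 := isRegularQuantile_gamma hm
  refine (hasStochIntegral_strip hB h3.continuous h2.continuous h3.mem_Icc h2.mem_Icc (tail_G₂ hm)
    h2.quantile_nonneg (memLp_Q₂ hm) ?_).congr ?_ (ae_of_all _ fun ω => rfl)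
  · filter_upwards [ae_mem_open_square] with p hp n
    exact h2.integral_stepInd hp.2 (Nat.cast_nonneg n)
  · filter_upwards [ae_mem_open_square] with p hp
    rw [levelAvg_G₃ hm hp.1]

/-- The strip theorem with the constant curve g = 0, whose level average is 1 at every v > 0. -/
lemma hasStochIntegral_Q₂ (hB : IsBivariateBrownianBridge B P) {m : ℕ} (hm : 1 ≤ m) :
    HasStochIntegral P B (fun p => Q₂ m p.2) (stripInt₂ m B) := by
  have h2 := isRegularQuantile_gamma hm
  refine (hasStochIntegral_strip hB (g := fun _ => 0) continuous_const h2.continuous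
    (fun _ => by simp) h2.mem_Icc (tail_G₂ hm)
    h2.quantile_nonneg (memLp_Q₂ hm) ?_).congr ?_ (ae_of_all _ fun ω => rfl)
  · filter_upwards [ae_mem_open_square] with p hp n
    exact h2.integral_stepInd hp.2 (Nat.cast_nonneg n)
  · filter_upwards [ae_mem_open_square] with p hp
    rw [levelAvg_zero hp.1.1, one_mul]

lemma hasStochIntegral_Q₃ (hB : IsBivariateBrownianBridge B P) {m : ℕ} (hm : 1 ≤ m) :
    HasStochIntegral P B (fun p => Q₃ m p.1) (stripInt₁ m B) := by
  have h3 := isRegularQuantile_beta hm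
  refine (hasStochIntegral_levelAvg hB h3.continuous (h := fun _ => 0) continuous_const h3.mem_Icc
    (fun _ => by simp)).congr ?_ (ae_of_all _ fun ω => ?_)
  · filter_upwards [ae_mem_open_square] with p hp
    rw [levelAvg_G₃ hm hp.1, levelAvg_zero hp.2.1, mul_one]
  · simp only [intervalIntegral.integral_const, sub_zero, one_smul, stripInt₁]
    rw [intervalIntegral.integral_of_le zero_le_one, integral_Icc_eq_integral_Ioc]

lemma hasStochIntegral_quantiles (hB : IsBivariateBrownianBridge B P) {m : ℕ} (hm : 1 ≤ m)
    (a b c : ℝ) :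
    HasStochIntegral P B (fun p => a * (Q₃ m p.1 * Q₂ m p.2) + b * Q₃ m p.1 + c * Q₂ m p.2)
      (fun ω => a * stripInt m B ω + b * stripInt₁ m B ω + c * stripInt₂ m B ω) :=
  (((hasStochIntegral_Q₃_mul_Q₂ hB hm).const_mul a).add hB
    ((hasStochIntegral_Q₃ hB hm).const_mul b)).add hB ((hasStochIntegral_Q₂ hB hm).const_mul c)

lemma hasLaw_quantiles (hB : IsBivariateBrownianBridge B P) {m : ℕ} (hm : 1 ≤ m)
    (a b c : ℝ) :
    HasLaw (fun ω => a * stripInt m B ω + b * stripInt₁ m B ω + c * stripInt₂ m B ω)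
      (gaussianReal 0 (a ^ 2 * (m / (2 * (2 * m + 1))) +
        (b + 2 * m * a) ^ 2 * (1 / (4 * (2 * m + 1))) + (c + a / 2) ^ 2 * (2 * m)).toNNReal) P := by
  rw [← sqVar_quantiles hm]
  exact (hasStochIntegral_quantiles hB hm a b c).hasLaw hB

/-- These coefficients are those of 2(Q₃-1/2)(Q₂-2m) with its constant term dropped. -/
lemma IsGoodPath.X₀_eq {Ω' : Type*} {B : ℝ → ℝ → Ω' → ℝ} {m : ℕ} {ω : Ω'}
    (h : IsGoodPath m B ω) (hm : 1 ≤ m) :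
    X₀ m B ω = 2 * stripInt m B ω + -(4 * m) * stripInt₁ m B ω + -1 * stripInt₂ m B ω := by
  rw [X₀, (h.integral_star₀ hm).2, stripInt, stripInt₁, stripInt₂]; ring

lemma IsGoodPath.X₁_eq {Ω' : Type*} {B : ℝ → ℝ → Ω' → ℝ} {m : ℕ} {ω : Ω'}
    (h : IsGoodPath m B ω) (hm : 1 ≤ m) :
    X₁ m B ω = 4 * m * stripInt₁ m B ω := by
  rw [X₁, stripInt₁, ← (h.integral_star₁ hm).2]; rfl

lemma IsGoodPath.X₂_eq {Ω' : Type*} {B : ℝ → ℝ → Ω' → ℝ} {m : ℕ} {ω : Ω'}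
    (h : IsGoodPath m B ω) (hm : 1 ≤ m) :
    X₂ m B ω = stripInt₂ m B ω := by
  rw [X₂, stripInt₂, ← (h.integral_star₂ hm).2]; rfl

end Laws

end Bridge

end

theorem mainTheorem7 {Ω : Type*} [MeasurableSpace Ω] (P : Measure Ω) [IsProbabilityMeasure P]
    (B : ℝ → ℝ → Ω → ℝ) (hB : Bridge.IsBivariateBrownianBridge B P) (m : ℕ) (hm : 1 ≤ m) :
    -- all the pathwise Lebesgue integrals below converge absolutely, almost surely
    (∀ᵐ ω ∂P,
      IntegrableOn (fun p : ℝ × ℝ =>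
        Bridge.q₃ m (1 - p.1) * Bridge.q₂ m (1 - p.2) * Bridge.star B p.1 p.2 ω)
        (Set.Icc 0 1 ×ˢ Set.Icc 0 1) ∧
      IntegrableOn (fun p : ℝ × ℝ =>
        Bridge.q₃ m (1 - p.1) * Bridge.q₂ m (1 - p.2) * Bridge.star₀ B p.1 p.2 ω)
        (Set.Icc 0 1 ×ˢ Set.Icc 0 1) ∧
      IntegrableOn (fun p : ℝ × ℝ =>
        Bridge.star₀ B (1 - Bridge.G₃ m p.1) (1 - Bridge.G₂ m p.2) ω)
        (Set.Icc 0 1 ×ˢ Set.Ici 0) ∧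
      IntegrableOn (fun v : ℝ => Bridge.q₃ m (1 - v) * Bridge.star₁ B v ω) (Set.Icc 0 1) ∧
      IntegrableOn (fun x : ℝ => Bridge.star₁ B (1 - Bridge.G₃ m x) ω) (Set.Icc 0 1) ∧
      IntegrableOn (fun x : ℝ => B (Bridge.G₃ m x) 1 ω) (Set.Icc 0 1) ∧
      IntegrableOn (fun w : ℝ => Bridge.q₂ m (1 - w) * Bridge.star B 1 w ω) (Set.Icc 0 1) ∧
      IntegrableOn (fun w : ℝ => Bridge.q₂ m w * B 1 w ω) (Set.Icc 0 1)) ∧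
    -- the integral of `(2 Q₃(v) - 1) Q₂(w)` exists, and has the following representations and law
    (∃ J : Ω → ℝ, Bridge.HasStochIntegral P B
      (fun p => (2 * Bridge.Q₃ m p.1 - 1) * Bridge.Q₂ m p.2) J) ∧
    (∀ J : Ω → ℝ, Bridge.HasStochIntegral P B
        (fun p => (2 * Bridge.Q₃ m p.1 - 1) * Bridge.Q₂ m p.2) J →
      (∀ᵐ ω ∂P, J ω =
        2 * (∫ p in Set.Icc (0 : ℝ) 1 ×ˢ Set.Icc (0 : ℝ) 1,
          Bridge.q₃ m (1 - p.1) * Bridge.q₂ m (1 - p.2) * Bridge.star B p.1 p.2 ω)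
        - ∫ w in Set.Icc (0 : ℝ) 1, Bridge.q₂ m (1 - w) * Bridge.star B 1 w ω) ∧
      (∀ᵐ ω ∂P, J ω = Bridge.X₀ m B ω + Bridge.X₁ m B ω) ∧
      (∀ᵐ ω ∂P, J ω =
        2 * (∫ p in Set.Icc (0 : ℝ) 1 ×ˢ Set.Ici (0 : ℝ),
          Bridge.star₀ B (1 - Bridge.G₃ m p.1) (1 - Bridge.G₂ m p.2) ω)
        + 4 * m * ∫ x in Set.Icc (0 : ℝ) 1, Bridge.star₁ B (1 - Bridge.G₃ m x) ω) ∧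
      HasLaw J (gaussianReal 0 (2 * m)) P) ∧
    -- the integral of `Q₂(w)` exists, and has the following representations
    (∃ J : Ω → ℝ, Bridge.HasStochIntegral P B (fun p => Bridge.Q₂ m p.2) J) ∧
    (∀ J : Ω → ℝ, Bridge.HasStochIntegral P B (fun p => Bridge.Q₂ m p.2) J →
      (∀ᵐ ω ∂P, J ω = -∫ w in Set.Icc (0 : ℝ) 1, Bridge.q₂ m w * B 1 w ω) ∧
      (∀ᵐ ω ∂P, J ω = ∫ w in Set.Icc (0 : ℝ) 1, Bridge.q₂ m (1 - w) * Bridge.star B 1 w ω) ∧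
      (∀ᵐ ω ∂P, J ω = Bridge.X₂ m B ω)) ∧
    -- other forms and laws of the three components
    (∀ᵐ ω ∂P, Bridge.X₀ m B ω =
      2 * ∫ p in Set.Icc (0 : ℝ) 1 ×ˢ Set.Ici (0 : ℝ),
        Bridge.star₀ B (1 - Bridge.G₃ m p.1) (1 - Bridge.G₂ m p.2) ω) ∧
    HasLaw (Bridge.X₀ m B) (gaussianReal 0 (2 * m / (2 * m + 1))) P ∧
    (∀ᵐ ω ∂P, Bridge.X₁ m B ω =
      4 * m * ∫ x in Set.Icc (0 : ℝ) 1, Bridge.star₁ B (1 - Bridge.G₃ m x) ω) ∧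
    (∀ᵐ ω ∂P, Bridge.X₁ m B ω = -(4 * m * ∫ x in Set.Icc (0 : ℝ) 1, B (Bridge.G₃ m x) 1 ω)) ∧
    HasLaw (Bridge.X₁ m B) (gaussianReal 0 (4 * m ^ 2 / (2 * m + 1))) P ∧
    HasLaw (Bridge.X₂ m B) (gaussianReal 0 (2 * m)) P ∧
    -- the three components are independent
    iIndepFun ![Bridge.X₀ m B, Bridge.X₁ m B, Bridge.X₂ m B] P := by
  classical
  have hm' : (0 : ℝ) < m := by exact_mod_cast hm
  have h3 := Bridge.isRegularQuantile_beta hm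
  have hgood := hB.ae_isGoodPath hm
  have hE₁ : ∀ᵐ ω ∂P, Bridge.X₁ m B ω =
      4 * m * ∫ x in Set.Icc (0 : ℝ) 1, Bridge.star₁ B (1 - Bridge.G₃ m x) ω := by
    filter_upwards [hgood] with ω h
    simp only [h.X₁_eq hm, Bridge.stripInt₁, Bridge.star₁, h.star_right_one_eq]
  have hE₀ : ∀ᵐ ω ∂P, Bridge.X₀ m B ω =
      2 * ∫ p in Set.Icc (0 : ℝ) 1 ×ˢ Set.Ici (0 : ℝ),
        Bridge.star₀ B (1 - Bridge.G₃ m p.1) (1 - Bridge.G₂ m p.2) ω := by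
    filter_upwards [hgood] with ω h
    rw [Bridge.X₀, (h.integral_star₀_strip hm).2]
  have hX₀ : Bridge.X₀ m B =ᵐ[P] fun ω => 2 * Bridge.stripInt m B ω +
      -(4 * m) * Bridge.stripInt₁ m B ω + -1 * Bridge.stripInt₂ m B ω := by
    filter_upwards [hgood] with ω h using h.X₀_eq hm
  have hX₁ : Bridge.X₁ m B =ᵐ[P] fun ω => 0 * Bridge.stripInt m B ω +
      4 * m * Bridge.stripInt₁ m B ω + 0 * Bridge.stripInt₂ m B ω := by
    filter_upwards [hgood] with ω h
    rw [h.X₁_eq hm]; ring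
  have hX₂ : Bridge.X₂ m B =ᵐ[P] fun ω => 0 * Bridge.stripInt m B ω +
      0 * Bridge.stripInt₁ m B ω + 1 * Bridge.stripInt₂ m B ω := by
    filter_upwards [hgood] with ω h
    rw [h.X₂_eq hm]; ring
  have hl₀ : HasLaw (Bridge.X₀ m B) (gaussianReal 0 (2 * m / (2 * m + 1))) P := by
    have hl := (Bridge.hasLaw_quantiles hB hm 2 (-(4 * m)) (-1)).congr hX₀
    convert hl using 2
    rw [← NNReal.coe_inj, Real.coe_toNNReal _ (by positivity)]
    push_cast
    field_simp
    ring
  have hl₁ : HasLaw (Bridge.X₁ m B) (gaussianReal 0 (4 * m ^ 2 / (2 * m + 1))) P := by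
    have hl := (Bridge.hasLaw_quantiles hB hm 0 (4 * m) 0).congr hX₁
    convert hl using 2
    rw [← NNReal.coe_inj, Real.coe_toNNReal _ (by positivity)]
    push_cast
    field_simp
    ring
  have hl₂ : HasLaw (Bridge.X₂ m B) (gaussianReal 0 (2 * m)) P := by
    have hl := (Bridge.hasLaw_quantiles hB hm 0 0 1).congr hX₂
    convert hl using 2
    rw [← NNReal.coe_inj, Real.coe_toNNReal _ (by positivity)]
    push_cast
    field_simp
    ring
  have hJ : Bridge.HasStochIntegral P B
      (fun p => (2 * Bridge.Q₃ m p.1 - 1) * Bridge.Q₂ m p.2)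
      (fun ω => 2 * Bridge.stripInt m B ω + 0 * Bridge.stripInt₁ m B ω +
        -1 * Bridge.stripInt₂ m B ω) :=
    (Bridge.hasStochIntegral_quantiles hB hm 2 0 (-1)).congr
      (ae_of_all _ fun p => by ring) (ae_of_all _ fun ω => rfl)
  refine ⟨?_, ⟨_, hJ⟩, fun J hJ' => ?_, ⟨_, Bridge.hasStochIntegral_Q₂ hB hm⟩, fun J hJ' => ?_,
    hE₀, hl₀, hE₁, ?_, hl₁, hl₂, ?_⟩
  · filter_upwards [hgood] with ω h
    refine ⟨(h.integral_star hm).1, (h.integral_star₀ hm).1, (h.integral_star₀_strip hm).1,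
      (h.integral_star₁ hm).1, ?_, ?_, (h.integral_star₂ hm).1, (h.integral_reflect hm).1⟩
    · simp only [Bridge.star₁, h.star_right_one_eq]
      exact (h.continuous_corner₁ hm).integrableOn_Icc
    · have hi := (h.continuous_corner₁ hm).neg.integrableOn_Icc (μ := volume) (a := 0) (b := 1)
      refine hi.congr_fun (fun x _ => ?_) measurableSet_Icc
      rw [Pi.neg_apply, h.corner_zero_right (h3.mem_Icc x), neg_neg]
  · have hu := hJ'.unique hB hJ
    refine ⟨?_, ?_, ?_, ?_⟩
    · filter_upwards [hu, hgood] with ω hω h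
      rw [hω, (h.integral_star hm).2, (h.integral_star₂ hm).2, Bridge.stripInt, Bridge.stripInt₂]
      ring
    · filter_upwards [hu, hgood] with ω hω h
      rw [hω, h.X₀_eq hm, h.X₁_eq hm]
      ring
    · filter_upwards [hu, hgood, hE₀, hE₁] with ω hω h e₀ e₁
      rw [← e₀, ← e₁, hω, h.X₀_eq hm, h.X₁_eq hm]
      ring
    · have hl := (Bridge.hasLaw_quantiles hB hm 2 0 (-1)).congr hu
      convert hl using 2
      rw [← NNReal.coe_inj, Real.coe_toNNReal _ (by positivity)]
      push_cast
      field_simp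
      ring
  · have hu := hJ'.unique hB (Bridge.hasStochIntegral_Q₂ hB hm)
    refine ⟨?_, ?_, ?_⟩
    · filter_upwards [hu, hgood] with ω hω h
      rw [hω, Bridge.stripInt₂, ← (h.integral_star₂ hm).2, (h.integral_reflect hm).2]
    · filter_upwards [hu, hgood] with ω hω h
      rw [hω, Bridge.stripInt₂, (h.integral_star₂ hm).2]
    · filter_upwards [hu, hgood] with ω hω h
      rw [hω, h.X₂_eq hm]
  · filter_upwards [hgood] with ω h
    rw [h.X₁_eq hm, Bridge.stripInt₁, setIntegral_congr_fun measurableSet_Icc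
      fun x _ => h.corner_zero_right (h3.mem_Icc x), integral_neg, mul_neg]
  · refine Bridge.iIndepFun_of_hasLaw_sum
      (σ := ![2 * m / (2 * m + 1), 4 * m ^ 2 / (2 * m + 1), 2 * m]) (fun i => ?_) fun t => ?_
    · fin_cases i
      · exact hl₀
      · exact hl₁
      · exact hl₂
    -- The coefficients of Σ tᵢXᵢ in the three strip integrals. They give b + 2ma = 4m t₁ and c +
    -- a/2 = t₂, so the variance has no cross terms.
    · have hl := Bridge.hasLaw_quantiles hB hm (2 * t 0) (-(4 * m) * t 0 + 4 * m * t 1)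
        (-t 0 + t 2)
      have hl' := hl.congr (Y := fun ω => ∑ i, t i *
          (![Bridge.X₀ m B, Bridge.X₁ m B, Bridge.X₂ m B] : Fin 3 → Ω → ℝ) i ω) (by
        filter_upwards [hgood] with ω h
        simp [Fin.sum_univ_three, h.X₀_eq hm, h.X₁_eq hm, h.X₂_eq hm]
        ring)
      convert hl' using 3
      simp [Fin.sum_univ_three]
      field_simp
      ring
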